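/- **Setting.** Let $d\in\{2,3\}$, let $\Omega\subset\mathbb R^d$ be a bounded open set (for instance a polygonal or polyhedral domain), $m\ge 1$, $T>0$. Write $(\cdot,\cdot)$, $\|\cdot\|$ for the inner product and norm of $L^2(\Omega)$ (scalar, vector or matrix valued), $\|\cdot\|_k$ for the norm of $H^k(\Omega)$, $X=H^1_0(\Omega)^d$, $Q=\{q\in L^2(\Omega):\int_\Omega q=0\}$, $\|F\|_{-1}=\sup_{v\in X}|F(v)|/\|\nabla v\|$, and $b(u,v,w)=\tfrac12\big(((u\cdot\nabla)v,w)-((u\cdot\nabla)w,v)\big)$. *Exact solution.* Let $\nu>0$ and let $u(t)\in X$, $p(t)\in Q$ satisfy $(\nabla\cdot u,q)=0$ for all $q\in Q$ and $$(u_t,v)+\nu(\nabla u,\nabla v)+b(u,u,v)-(p,\nabla\cdot v)=(f,v)\qquad\forall v\in X,\ t\in(0,T],$$ with $u\in L^\infty(0,T;H^{m+1})$, $p\in L^\infty(0,T;H^m)$ (point values $u(t)\in H^{m+1}$, $p(t)\in H^m$ existing for all $t\in[0,T]$), $u_{tt}\in L^2(0,T;H^1)$, $f\in L^2(0,T;H^{-1})$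 (with $f(t)\in H^{-1}$ for all $t\in[0,T]$). *Discretization.* Let $M\ge1$, $\Delta t=T/M$, $t^n=n\Delta t$, $g^n=g(t^n)$, $|||g|||_{\infty,k}=\max_{0\le n\le M}\|g^n\|_k$ and $|||g|||_{2,k}=\big(\Delta t\sum_{n=0}^M\|g^n\|_k^2\big)^{1/2}$. Let $h>0$ and let $X^h\subset X$, $Q^h\subset Q$ be subspaces (e.g. conforming finite element spaces) with $\inf_{q_h\in Q^h}\|q-q_h\|\le C_{ap}h^m\|q\|_m$ for all $q\in Q\cap H^m(\Omega)$, and $V^h=\{v\in X^h:(\nabla\cdot v,q)=0\ \forall q\in Q^h\}$. *POD.* Let $u_h^1,\dots,u_h^M\in V^h$ be snapshots, of rank $N$, let $\lambda_1\ge\dots\ge\lambda_N>0$ be the non-zero eigenvalues of the correlation matrix $K_{kl}=\frac1M(u_h^k,u_h^l)$ with orthonormal eigenvectors $v_1,\dots,v_N$, and $\psi_j=(M\lambda_j)^{-1/2}\sum_k (v_j)_k u_h^k$. For $s\le N$ put $X^s=\mathrm{span}\{\psi_1,\dots,\psi_s\}$, let $(S_s)_{ij}=(\nabla\psi_j,\nabla\psi_i)$,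 $1\le i,j\le s$, and let $\|S_s\|_2$ be its matrix 2-norm. Let $R<r\le N$. For vector fields $P_s$ is the $L^2$-orthogonal projection onto $X^s$; for matrix fields $P_R$ is the $L^2$-orthogonal projection onto $\mathrm{span}\{\nabla\psi_1,\dots,\nabla\psi_R\}$. *Projection assumption.* For some $\delta\ge0$ (e.g. $\delta=0$ or $\delta=1$), for $s\in\{r,R\}$ and $n=1,\dots,M$, $$\|u^n-P_su^n\|^2\le C_a\Big(h^{2m+2}|||u|||_{2,m+1}^2+\delta\Delta t^2+\sum_{j=s+1}^N\lambda_j\Big),\qquad \|\nabla(u^n-P_su^n)\|^2\le C_a\,A_s,$$ $$A_s:=\big(h^{2m}+\|S_s\|_2h^{2m+2}\big)|||u|||_{2,m+1}^2+\delta(1+\|S_s\|_2)\Delta t^2+\sum_{j=s+1}^N\|\psi_j\|_1^2\lambda_j .$$ *Scheme.* Let $\nu_T>0$, $u_r^0=w_r^0=P_ru(0)$, and for $0\le n<M$ let $w_r^{n+1},u_r^{n+1}\in X^r$ satisfy, for all $\psi\in X^r$, $$\Big(\tfrac{w_r^{n+1}-u_r^n}{\Delta t},\psi\Big)+b(w_r^{n+1},w_r^{n+1},\psi)+\nu(\nabla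 w_r^{n+1},\nabla\psi)=(f^{n+1},\psi),$$ $$\Big(\tfrac{w_r^{n+1}-u_r^{n+1}}{\Delta t},\psi\Big)=\Big(\nu_T(I-P_R)\nabla\tfrac{w_r^{n+1}+u_r^{n+1}}2,(I-P_R)\nabla\psi\Big).$$ **Theorem.** There is a constant $C>0$, depending only on $d$, $\Omega$, $m$, $T$, $C_{ap}$ and $C_a$, such that in every such situation with $C\nu^{-3}|||\nabla u|||_{\infty,0}^4\,\Delta t\le1$ one has $$\|u^M-u_r^M\|^2+\sum_{n=0}^{M-1}\Big[\tfrac14\Delta t\,\nu_T\big\|(I-P_R)\nabla\big(u^{n+1}-\tfrac{u_r^{n+1}+w_r^{n+1}}2\big)\big\|^2+\nu\Delta t\|\nabla(u^{n+1}-w_r^{n+1})\|^2\Big]$$ $$\le C_*\Big[h^{2m+2}|||u|||_{2,m+1}^2+\delta\Delta t^2+\sum_{j=r+1}^N\lambda_j+\Big(\nu+\nu^{-1}|||\nabla u|||_{2,0}^2+\nu^{-2}\big(\|u_r^0\|^2+\nu^{-1}|||f|||_{2,-1}^2\big)\Big)A_r$$ $$+\nu_T\Big(\big(h^{2m}+(\|S_R\|_2+\|S_r\|_2)h^{2m+2}\big)|||u|||_{2,m+1}^2+\delta(1+\|S_R\|_2+\|S_r\|_2)\Delta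 t^2+\sum_{j=R+1}^N\|\psi_j\|_1^2\lambda_j+\sum_{j=r+1}^N\|\psi_j\|_1^2\lambda_j\Big)$$ $$+\nu^{-1}h^{2m}|||p|||_{2,m}^2+\nu^{-1}\Delta t^2\|u_{tt}\|_{L^2(0,T;H^1)}^2\Big],$$ where $$C_*=C\exp\Big(C\min\big\{\nu^{-3}|||\nabla u|||_{\infty,0}^4,\ \|S_r\|_2^{3/4}\,|||\nabla u|||_{\infty,0}\big\}\Big).$$ In particular $C_*\le C\exp\big(C\|S_r\|_2^{3/4}|||\nabla u|||_{\infty,0}\big)$, so given bounds for $|||\nabla u|||_{\infty,0}$ and $\|S_r\|_2$ the constant is independent of $\Delta t$, $h$, $\nu$ and $\nu_T$. -/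

import Mathlib

open MeasureTheory Set
open scoped ContDiff

noncomputable section

namespace VmsPod

/-! ### Lebesgue and Sobolev spaces on a set `Ω ⊆ ℝ^d` -/

/-- The scalar space `L²(Ω)`. -/
abbrev L2 {d : ℕ} (Ω : Set (EuclideanSpace ℝ (Fin d))) : Type :=
  Lp ℝ 2 (volume.restrict Ω)

/-- The space `L²(Ω)^d` of vector fields; its inner product is the sum of the componentwise ones. -/
abbrev L2Vec {d : ℕ} (Ω : Set (EuclideanSpace ℝ (Fin d))) : Type :=
  PiLp 2 (fun _ : Fin d => L2 Ω)

/-- The space `L²(Ω)^{d×d}` of matrix fields, with the Frobenius inner product. -/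
abbrev L2Mat {d : ℕ} (Ω : Set (EuclideanSpace ℝ (Fin d))) : Type :=
  PiLp 2 (fun _ : Fin d × Fin d => L2 Ω)

/-- `φ ∈ C_c^∞(Ω)`. -/
def IsTest {d : ℕ} (Ω : Set (EuclideanSpace ℝ (Fin d)))
    (φ : EuclideanSpace ℝ (Fin d) → ℝ) : Prop :=
  ContDiff ℝ ∞ φ ∧ HasCompactSupport φ ∧ tsupport φ ⊆ Ω

/-- The classical partial derivative `∂_i φ`. -/
def partialD {d : ℕ} (i : Fin d) (φ : EuclideanSpace ℝ (Fin d) → ℝ) :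
    EuclideanSpace ℝ (Fin d) → ℝ :=
  fun x => fderiv ℝ φ x (EuclideanSpace.single i 1)

/-- The classical derivative `D^α φ` for a multi-index `α`. -/
def multiD {d : ℕ} (α : Fin d → ℕ) (φ : EuclideanSpace ℝ (Fin d) → ℝ) :
    EuclideanSpace ℝ (Fin d) → ℝ :=
  (List.finRange d).foldr (fun i g => (partialD i)^[α i] g) φ

/-- `g ∈ L²(Ω)` is the weak derivative `D^α f` of `f ∈ L²(Ω)`. -/
def HasWeakDeriv {d : ℕ} {Ω : Set (EuclideanSpace ℝ (Fin d))} (α : Fin d → ℕ) (f g : L2 Ω) :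
    Prop :=
  ∀ φ : EuclideanSpace ℝ (Fin d) → ℝ, IsTest Ω φ →
    ∫ x in Ω, f x * multiD α φ x = (-1 : ℝ) ^ (∑ i, α i) * ∫ x in Ω, g x * φ x

open Classical in
/-- The weak derivative `D^α f`, if it exists in `L²(Ω)` (and `0` otherwise). -/
def weakDeriv {d : ℕ} {Ω : Set (EuclideanSpace ℝ (Fin d))} (α : Fin d → ℕ) (f : L2 Ω) : L2 Ω :=
  if h : ∃ g : L2 Ω, HasWeakDeriv α f g then h.choose else 0

/-- The multi-indices `α` with `|α| ≤ k`. -/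
def multiIdx (d k : ℕ) : Finset (Fin d → ℕ) :=
  (Fintype.piFinset fun _ => Finset.range (k + 1)).filter fun α => ∑ i, α i ≤ k

/-- `f ∈ H^k(Ω)`. -/
def MemH {d : ℕ} {Ω : Set (EuclideanSpace ℝ (Fin d))} (k : ℕ) (f : L2 Ω) : Prop :=
  ∀ α ∈ multiIdx d k, ∃ g : L2 Ω, HasWeakDeriv α f g

/-- The norm `‖f‖_k` of `H^k(Ω)`. -/
def normH {d : ℕ} {Ω : Set (EuclideanSpace ℝ (Fin d))} (k : ℕ) (f : L2 Ω) : ℝ :=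
  Real.sqrt (∑ α ∈ multiIdx d k, ‖weakDeriv α f‖ ^ 2)

/-- `u ∈ H^k(Ω)^d`. -/
def MemHVec {d : ℕ} {Ω : Set (EuclideanSpace ℝ (Fin d))} (k : ℕ) (u : L2Vec Ω) : Prop :=
  ∀ i, MemH k (u i)

/-- The norm `‖u‖_k` of `H^k(Ω)^d`. -/
def normHVec {d : ℕ} {Ω : Set (EuclideanSpace ℝ (Fin d))} (k : ℕ) (u : L2Vec Ω) : ℝ :=
  Real.sqrt (∑ i, normH k (u i) ^ 2)

/-- The gradient, with entries `(∇u)_{ij} = ∂_j u_i`. -/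
def grad {d : ℕ} {Ω : Set (EuclideanSpace ℝ (Fin d))} (u : L2Vec Ω) : L2Mat Ω :=
  WithLp.toLp 2 fun ij => weakDeriv (Pi.single ij.2 1) (u ij.1)

/-- The divergence `∇·u = ∑ᵢ ∂_i u_i`. -/
def divg {d : ℕ} {Ω : Set (EuclideanSpace ℝ (Fin d))} (u : L2Vec Ω) : L2 Ω :=
  ∑ i, weakDeriv (Pi.single i 1) (u i)

theorem partialD_add {d : ℕ} {Ω : Set (EuclideanSpace ℝ (Fin d))} (i : Fin d)
    {φ χ : EuclideanSpace ℝ (Fin d) → ℝ} (hφ : IsTest Ω φ) (hχ : IsTest Ω χ) :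
    partialD i (φ + χ) = partialD i φ + partialD i χ := by
  funext x
  have h1 : DifferentiableAt ℝ φ x := (hφ.1.differentiable (by simp)) x
  have h2 : DifferentiableAt ℝ χ x := (hχ.1.differentiable (by simp)) x
  simp [partialD, fderiv_add h1 h2]

theorem partialD_smul {d : ℕ} {Ω : Set (EuclideanSpace ℝ (Fin d))} (i : Fin d) (c : ℝ)
    {φ : EuclideanSpace ℝ (Fin d) → ℝ} (hφ : IsTest Ω φ) :
    partialD i (c • φ) = c • partialD i φ := by
  funext x
  have h1 : DifferentiableAt ℝ φ x := (hφ.1.differentiable (by simp)) x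
  simp [partialD, fderiv_const_smul h1]

theorem isTest_zero {d : ℕ} (Ω : Set (EuclideanSpace ℝ (Fin d))) : IsTest Ω 0 := by
  refine ⟨contDiff_const, HasCompactSupport.zero, ?_⟩
  have : tsupport (0 : EuclideanSpace ℝ (Fin d) → ℝ) = ∅ := by simp [tsupport]
  simp [this]

theorem IsTest.add {d : ℕ} {Ω : Set (EuclideanSpace ℝ (Fin d))}
    {φ χ : EuclideanSpace ℝ (Fin d) → ℝ} (hφ : IsTest Ω φ) (hχ : IsTest Ω χ) :
    IsTest Ω (φ + χ) :=
  ⟨hφ.1.add hχ.1, hφ.2.1.add hχ.2.1,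
    (tsupport_add φ χ).trans (union_subset hφ.2.2 hχ.2.2)⟩

theorem IsTest.smul {d : ℕ} {Ω : Set (EuclideanSpace ℝ (Fin d))} (c : ℝ)
    {φ : EuclideanSpace ℝ (Fin d) → ℝ} (hφ : IsTest Ω φ) : IsTest Ω (c • φ) :=
  ⟨contDiff_const.smul hφ.1, hφ.2.1.smul_left (f := fun _ => c),
    (tsupport_smul_subset_right (fun _ => c) φ).trans hφ.2.2⟩

/-- The pairs `(φ, ∇φ)`, `φ ∈ C_c^∞(Ω)`, as a subspace of `L²(Ω) × L²(Ω)^d`. -/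
def testGraph {d : ℕ} (Ω : Set (EuclideanSpace ℝ (Fin d))) :
    Submodule ℝ (L2 Ω × (Fin d → L2 Ω)) where
  carrier := {fG | ∃ φ : EuclideanSpace ℝ (Fin d) → ℝ, IsTest Ω φ ∧
    fG.1 =ᵐ[volume.restrict Ω] φ ∧ ∀ i, fG.2 i =ᵐ[volume.restrict Ω] partialD i φ}
  add_mem' := by
    rintro a b ⟨φ, hφ, h1, h2⟩ ⟨χ, hχ, k1, k2⟩
    refine ⟨φ + χ, hφ.add hχ, (Lp.coeFn_add _ _).trans (h1.add k1), fun i => ?_⟩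
    rw [partialD_add i hφ hχ]
    exact (Lp.coeFn_add _ _).trans ((h2 i).add (k2 i))
  zero_mem' := by
    refine ⟨0, isTest_zero Ω, Lp.coeFn_zero _ _ _, fun i => ?_⟩
    have : partialD i (0 : EuclideanSpace ℝ (Fin d) → ℝ) = 0 := by
      funext x; simp [partialD]
    rw [this]
    exact Lp.coeFn_zero _ _ _
  smul_mem' := by
    rintro c a ⟨φ, hφ, h1, h2⟩
    refine ⟨c • φ, hφ.smul c, (Lp.coeFn_smul _ _).trans (h1.const_smul c), fun i => ?_⟩
    rw [partialD_smul i c hφ]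
    exact (Lp.coeFn_smul _ _).trans ((h2 i).const_smul c)

/-- `H_0^1(Ω)`: the closure of `C_c^∞(Ω)` in the `H^1` norm (convergence of the functions and of
their gradients in `L²`). -/
def H10 {d : ℕ} (Ω : Set (EuclideanSpace ℝ (Fin d))) : Submodule ℝ (L2 Ω) :=
  (testGraph Ω).topologicalClosure.map (LinearMap.fst ℝ (L2 Ω) (Fin d → L2 Ω))

/-- The velocity space `X = H_0^1(Ω)^d`. -/
def VelX {d : ℕ} (Ω : Set (EuclideanSpace ℝ (Fin d))) : Submodule ℝ (L2Vec Ω) where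
  carrier := {v | ∀ i, v i ∈ H10 Ω}
  add_mem' := fun ha hb i => (H10 Ω).add_mem (ha i) (hb i)
  zero_mem' := fun _ => (H10 Ω).zero_mem
  smul_mem' := fun c _ ha i => (H10 Ω).smul_mem c (ha i)

/-- Membership in the pressure space `Q = L_0^2(Ω)`. -/
def MemQ {d : ℕ} {Ω : Set (EuclideanSpace ℝ (Fin d))} (q : L2 Ω) : Prop :=
  ∫ x in Ω, q x = 0

/-- The convective form `((u·∇)v, w)`. -/
def conv {d : ℕ} {Ω : Set (EuclideanSpace ℝ (Fin d))} (u v w : L2Vec Ω) : ℝ :=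
  ∫ x in Ω, ∑ i, ∑ j, u j x * grad v (i, j) x * w i x

/-- The skew-symmetric trilinear form `b(u,v,w)`. -/
def triB {d : ℕ} {Ω : Set (EuclideanSpace ℝ (Fin d))} (u v w : L2Vec Ω) : ℝ :=
  (1 / 2) * (conv u v w - conv u w v)

/-- The linear functional `F` on `X` belongs to the dual space `H^{-1}`. -/
def IsHNeg {d : ℕ} {Ω : Set (EuclideanSpace ℝ (Fin d))} (F : VelX Ω →ₗ[ℝ] ℝ) : Prop :=
  ∃ c : ℝ, ∀ v : VelX Ω, |F v| ≤ c * ‖grad (v : L2Vec Ω)‖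

/-- The dual norm `‖F‖_{-1} = sup_{v ∈ X} |F(v)| / ‖∇v‖`. -/
def normHNeg {d : ℕ} {Ω : Set (EuclideanSpace ℝ (Fin d))} (F : VelX Ω →ₗ[ℝ] ℝ) : ℝ :=
  ⨆ v : VelX Ω, |F v| / ‖grad (v : L2Vec Ω)‖

/-! ### Discrete norms in time -/

/-- `max_{0 ≤ n ≤ M} a n`. -/
def discMax (M : ℕ) (a : ℕ → ℝ) : ℝ :=
  (Finset.range (M + 1)).sup' Finset.nonempty_range_add_one a

/-- `(Δt ∑_{n=0}^{M} (a n)^2)^{1/2}`. -/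
def discL2 (Δt : ℝ) (M : ℕ) (a : ℕ → ℝ) : ℝ :=
  Real.sqrt (Δt * ∑ n ∈ Finset.range (M + 1), a n ^ 2)

/-! ### The Navier–Stokes equations -/

/-- `(u, p)` is a weak solution on `[0, T]` with viscosity `ν` and force `f`; `ut` is the time
derivative of `u`. -/
structure IsWeakSolution {d : ℕ} (Ω : Set (EuclideanSpace ℝ (Fin d))) (ν T : ℝ)
    (f : ℝ → VelX Ω →ₗ[ℝ] ℝ) (u ut : ℝ → L2Vec Ω) (p : ℝ → L2 Ω) : Prop where
  mem_X : ∀ t ∈ Icc 0 T, u t ∈ VelX Ω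
  mem_Q : ∀ t ∈ Icc 0 T, MemQ (p t)
  deriv : ∀ t ∈ Icc 0 T, HasDerivWithinAt u (ut t) (Icc 0 T) t
  momentum : ∀ t ∈ Ioc 0 T, ∀ v : VelX Ω,
    inner ℝ (ut t) (v : L2Vec Ω) + ν * inner ℝ (grad (u t)) (grad (v : L2Vec Ω))
      + triB (u t) (u t) v - inner ℝ (p t) (divg (v : L2Vec Ω)) = f t v
  incompressible : ∀ t ∈ Ioc 0 T, ∀ q : L2 Ω, MemQ q → inner ℝ q (divg (u t)) = 0

/-- The regularity `u ∈ L^∞(0,T;H^{m+1})`, `p ∈ L^∞(0,T;H^m)`, `u_tt ∈ L²(0,T;H^1)`,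
`f ∈ L²(0,T;H^{-1})`. Point values in time are used, so the spatial regularity holds at every time;
`utt` is the weak time derivative of `ut`. -/
structure IsRegularSolution {d : ℕ} (Ω : Set (EuclideanSpace ℝ (Fin d))) (m : ℕ) (T : ℝ)
    (f : ℝ → VelX Ω →ₗ[ℝ] ℝ) (u ut utt : ℝ → L2Vec Ω) (p : ℝ → L2 Ω) : Prop where
  u_mem : ∀ t ∈ Icc 0 T, MemHVec (m + 1) (u t)
  u_bdd : ∃ B : ℝ, ∀ᵐ t ∂(volume.restrict (Icc 0 T)), normHVec (m + 1) (u t) ≤ B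
  p_mem : ∀ t ∈ Icc 0 T, MemH m (p t)
  p_bdd : ∃ B : ℝ, ∀ᵐ t ∂(volume.restrict (Icc 0 T)), normH m (p t) ≤ B
  utt_meas : AEStronglyMeasurable utt (volume.restrict (Icc 0 T))
  utt_mem : ∀ᵐ t ∂(volume.restrict (Icc 0 T)), MemHVec 1 (utt t)
  utt_int : IntegrableOn (fun t => normHVec 1 (utt t) ^ 2) (Icc 0 T)
  utt_deriv : ∀ t ∈ Icc 0 T, ut t = ut 0 + ∫ s in (0 : ℝ)..t, utt s
  f_mem : ∀ t ∈ Icc 0 T, IsHNeg (f t)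
  f_meas : ∀ v : VelX Ω, AEMeasurable (fun t => f t v) (volume.restrict (Icc 0 T))
  f_int : IntegrableOn (fun t => normHNeg (f t) ^ 2) (Icc 0 T)

/-! ### Proper orthogonal decomposition -/

/-- The snapshot correlation matrix `K_{kl} = (1/M) (y_k, y_l)`. -/
def corrMatrix {d : ℕ} {Ω : Set (EuclideanSpace ℝ (Fin d))} {M : ℕ} (y : Fin M → L2Vec Ω) :
    Matrix (Fin M) (Fin M) ℝ :=
  Matrix.of fun k l => (1 / (M : ℝ)) * inner ℝ (y k) (y l)

/-- `ψ 0, …, ψ (N-1)` is a POD basis of the snapshots `y`, with positive eigenvalues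
`lam 0 ≥ … ≥ lam (N-1)`, where `N` is the rank of the snapshots. The enumeration starts at `0`
(so `ψ j` is the `(j+1)`-st mode), and the values of `ψ` and `lam` from `N` on are irrelevant. -/
structure IsPODBasis {d : ℕ} {Ω : Set (EuclideanSpace ℝ (Fin d))} {M : ℕ} (y : Fin M → L2Vec Ω)
    (N : ℕ) (ψ : ℕ → L2Vec Ω) (lam : ℕ → ℝ) : Prop where
  rank : N = Module.finrank ℝ (Submodule.span ℝ (Set.range y))
  lam_pos : ∀ j < N, 0 < lam j
  lam_anti : ∀ i j, i ≤ j → j < N → lam j ≤ lam i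
  eigen : ∃ v : Fin N → EuclideanSpace ℝ (Fin M), Orthonormal ℝ v ∧ ∀ l : Fin N,
    (corrMatrix y).mulVec (v l) = lam l • (v l : Fin M → ℝ) ∧
    ψ l = (1 / Real.sqrt (M * lam l)) • ∑ k, v l k • y k

/-- The POD space spanned by the first `r` modes. -/
def podSpace {d : ℕ} {Ω : Set (EuclideanSpace ℝ (Fin d))} (ψ : ℕ → L2Vec Ω) (r : ℕ) :
    Submodule ℝ (L2Vec Ω) :=
  Submodule.span ℝ (Set.range fun j : Fin r => ψ j)

/-- The space spanned by the gradients of the first `R` modes. -/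
def podGradSpace {d : ℕ} {Ω : Set (EuclideanSpace ℝ (Fin d))} (ψ : ℕ → L2Vec Ω) (R : ℕ) :
    Submodule ℝ (L2Mat Ω) :=
  Submodule.span ℝ (Set.range fun j : Fin R => grad (ψ j))

instance {d : ℕ} {Ω : Set (EuclideanSpace ℝ (Fin d))} (ψ : ℕ → L2Vec Ω) (r : ℕ) :
    FiniteDimensional ℝ (podSpace ψ r) :=
  FiniteDimensional.span_of_finite ℝ (Set.finite_range _)

instance {d : ℕ} {Ω : Set (EuclideanSpace ℝ (Fin d))} (ψ : ℕ → L2Vec Ω) (R : ℕ) :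
    FiniteDimensional ℝ (podGradSpace ψ R) :=
  FiniteDimensional.span_of_finite ℝ (Set.finite_range _)

/-- The `L²` projection `P_r` onto the POD space. -/
def podProj {d : ℕ} {Ω : Set (EuclideanSpace ℝ (Fin d))} (ψ : ℕ → L2Vec Ω) (r : ℕ)
    (u : L2Vec Ω) : L2Vec Ω :=
  (podSpace ψ r).starProjection u

/-- The fluctuation `(I - P_R) G` of a matrix field, `P_R` being the `L²` projection onto the
span of the gradients of the first `R` modes. -/
def fluct {d : ℕ} {Ω : Set (EuclideanSpace ℝ (Fin d))} (ψ : ℕ → L2Vec Ω) (R : ℕ)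
    (G : L2Mat Ω) : L2Mat Ω :=
  G - (podGradSpace ψ R).starProjection G

/-- The POD stiffness matrix `(S_r)_{ij} = (∇ψ_j, ∇ψ_i)`. -/
def stiffness {d : ℕ} {Ω : Set (EuclideanSpace ℝ (Fin d))} (ψ : ℕ → L2Vec Ω) (r : ℕ) :
    Matrix (Fin r) (Fin r) ℝ :=
  Matrix.of fun i j => inner ℝ (grad (ψ j)) (grad (ψ i))

/-- The matrix 2-norm `‖S_r‖_2` of the stiffness matrix. -/
def stiffNorm {d : ℕ} {Ω : Set (EuclideanSpace ℝ (Fin d))} (ψ : ℕ → L2Vec Ω) (r : ℕ) : ℝ :=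
  ‖Matrix.toEuclideanCLM (𝕜 := ℝ) (stiffness ψ r)‖

/-- The `L²` tail `∑_{j>s} λ_j`. -/
def tail (N : ℕ) (lam : ℕ → ℝ) (s : ℕ) : ℝ :=
  ∑ j ∈ Finset.Ico s N, lam j

/-- The `H^1` tail `∑_{j>s} ‖ψ_j‖_1² λ_j`. -/
def tailH1 {d : ℕ} {Ω : Set (EuclideanSpace ℝ (Fin d))} (N : ℕ) (ψ : ℕ → L2Vec Ω)
    (lam : ℕ → ℝ) (s : ℕ) : ℝ :=
  ∑ j ∈ Finset.Ico s N, normHVec 1 (ψ j) ^ 2 * lam j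

/-- The backward Euler post-processed VMS-POD scheme with `M` steps of size `Δt`: Galerkin POD
step for `w`, then post-processing step for `ur`. -/
structure IsVmsPodScheme {d : ℕ} {Ω : Set (EuclideanSpace ℝ (Fin d))} (ν νT Δt : ℝ) (M r R : ℕ)
    (ψ : ℕ → L2Vec Ω) (f : ℝ → VelX Ω →ₗ[ℝ] ℝ) (u0 : L2Vec Ω) (ur w : ℕ → L2Vec Ω) : Prop where
  init_ur : ur 0 = podProj ψ r u0
  init_w : w 0 = podProj ψ r u0
  mem_ur : ∀ n ≤ M, ur n ∈ podSpace ψ r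
  mem_w : ∀ n ≤ M, w n ∈ podSpace ψ r
  step1 : ∀ n < M, ∀ χ : VelX Ω, (χ : L2Vec Ω) ∈ podSpace ψ r →
    inner ℝ ((1 / Δt) • (w (n + 1) - ur n)) (χ : L2Vec Ω) + triB (w (n + 1)) (w (n + 1)) χ
      + ν * inner ℝ (grad (w (n + 1))) (grad (χ : L2Vec Ω)) = f ((n + 1 : ℕ) * Δt) χ
  step2 : ∀ n < M, ∀ χ ∈ podSpace ψ r,
    inner ℝ ((1 / Δt) • (w (n + 1) - ur (n + 1))) χ
      = νT * inner ℝ (fluct ψ R (grad ((1 / 2 : ℝ) • (w (n + 1) + ur (n + 1)))))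
          (fluct ψ R (grad χ))

/-- The projection error assumption at the times `t^1, …, t^M` for the first `s` modes, with
constant `Ca`. Here `U2` is the squared discrete norm of the exact solution, and `δ` is the weight
of the temporal part. -/
def ProjAssumption {d : ℕ} {Ω : Set (EuclideanSpace ℝ (Fin d))} (Ca h δ Δt U2 : ℝ) (m M N : ℕ)
    (ψ : ℕ → L2Vec Ω) (lam : ℕ → ℝ) (u : ℝ → L2Vec Ω) (s : ℕ) : Prop :=
  ∀ n : ℕ, 1 ≤ n → n ≤ M →
    ‖u (n * Δt) - podProj ψ s (u (n * Δt))‖ ^ 2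
      ≤ Ca * (h ^ (2 * m + 2) * U2 + δ * Δt ^ 2 + tail N lam s) ∧
    ‖grad (u (n * Δt) - podProj ψ s (u (n * Δt)))‖ ^ 2
      ≤ Ca * ((h ^ (2 * m) + stiffNorm ψ s * h ^ (2 * m + 2)) * U2
          + δ * (1 + stiffNorm ψ s) * Δt ^ 2 + tailH1 N ψ lam s)

end VmsPod

end

open VmsPod

/-! The proof is an energy argument for the discrete errors against `v n`, the `L²` projection of
the exact solution at `n * Δt` onto the POD space. With `η = u - v` and `φ = w - v`, so that `u - w
= η - φ`, the error equation of the Galerkin step is tested with `φ`. Since `v` is an `L²`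
projection and `φ` lies in the POD space, the time difference of `η` drops out. Since `φ` is
discretely divergence free, the pressure enters only through its distance to `Qh`. The backward
difference contributes a Taylor remainder controlled by `utt`.

The convective terms are split by `SobolevSix.triB_sub_triB` into two terms carrying `η`, which are
sources, and the critical term `b(φ, u, φ)`. The latter is bounded by `‖∇u‖ ‖φ‖^{1/2} ‖∇φ‖^{3/2}`,
which follows from `H_0^1 ⊆ L^6` and Hölder. It becomes a multiple of `‖φ‖²` either by Young, at the
price `ν^{-3} ‖∇u‖^4`, or by the inverse inequality on the POD space, at the price `‖S_r‖^{3/4}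
‖∇u‖`. The minimum of the two is the growth rate (`convective_growth_le`). The source `b(w, η, φ)`
contains `‖∇w‖`, which is controlled only after summation in time, by the energy estimate
`IsVmsPodScheme.stability`.

The post-processing equation is tested with the mean of `w - v` and `ur - v`. Its left side becomes
a difference of squares, so the step does not enlarge the error except through the fluctuation of
`∇v` (`postprocessing_error_step`). Chaining both steps gives a Gronwall inequality with zero
initial error (`discrete_gronwall`), and the triangle inequality adds the projection errors. -/

noncomputable section

namespace VmsPod

/-! ### Weak derivatives and the gradient on `H_0^1` -/

section WeakDeriv

variable {d : ℕ} {Ω : Set (EuclideanSpace ℝ (Fin d))}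

theorem IsTest.memLp {φ : EuclideanSpace ℝ (Fin d) → ℝ} (hφ : IsTest Ω φ) (p : ENNReal)
    (μ : Measure (EuclideanSpace ℝ (Fin d))) [IsFiniteMeasureOnCompacts μ] : MemLp φ p μ :=
  hφ.1.continuous.memLp_of_hasCompactSupport hφ.2.1

theorem IsTest.partialD {φ : EuclideanSpace ℝ (Fin d) → ℝ} (hφ : IsTest Ω φ) (i : Fin d) :
    IsTest Ω (partialD i φ) := by
  refine ⟨?_, ?_, ?_⟩
  · exact (hφ.1.fderiv_right (m := ∞) (by simp)).clm_apply contDiff_const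
  · exact hφ.2.1.fderiv_apply (𝕜 := ℝ) _
  · exact (tsupport_fderiv_apply_subset ℝ _).trans hφ.2.2

theorem multiD_zero (φ : EuclideanSpace ℝ (Fin d) → ℝ) : multiD 0 φ = φ := by
  have (l : List (Fin d)) :
      l.foldr (fun i g => (VmsPod.partialD i)^[(0 : Fin d → ℕ) i] g) φ = φ := by
    induction l with
    | nil => rfl
    | cons a l ih => simp
  exact this _

theorem multiD_single (i : Fin d) (φ : EuclideanSpace ℝ (Fin d) → ℝ) :
    multiD (Pi.single i 1) φ = VmsPod.partialD i φ := by
  have h0 (l : List (Fin d)) (hl : i ∉ l) : l.foldr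
      (fun j g => (VmsPod.partialD j)^[(Pi.single i 1 : Fin d → ℕ) j] g) φ = φ := by
    induction l with
    | nil => rfl
    | cons a l ih =>
      simp only [List.mem_cons, not_or] at hl
      simp [Pi.single_eq_of_ne (Ne.symm hl.1), ih hl.2]
  have h1 (l : List (Fin d)) (hl : i ∈ l) (hn : l.Nodup) : l.foldr
      (fun j g => (VmsPod.partialD j)^[(Pi.single i 1 : Fin d → ℕ) j] g) φ
        = VmsPod.partialD i φ := by
    induction l with
    | nil => simp at hl
    | cons a l ih =>
      rw [List.nodup_cons] at hn
      by_cases ha : a = i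
      · subst ha
        simp [h0 l hn.1]
      · have hl' : i ∈ l := by
          rcases List.mem_cons.1 hl with h | h
          · exact absurd h.symm ha
          · exact h
        simp [Pi.single_eq_of_ne ha, ih hl' hn.2]
  exact h1 _ (List.mem_finRange i) (List.nodup_finRange d)

/-- Makes pairings with test functions visibly linear and continuous in `f`. -/
theorem integral_mul_eq_inner (f : L2 Ω) {φ : EuclideanSpace ℝ (Fin d) → ℝ}
    (hφ : MemLp φ 2 (volume.restrict Ω)) :
    ∫ x in Ω, f x * φ x = inner ℝ (hφ.toLp φ) f := by
  rw [L2.inner_def]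
  refine integral_congr_ae ?_
  filter_upwards [hφ.coeFn_toLp] with x hx
  simp [hx]

/-- The fundamental lemma of the calculus of variations. It identifies the element picked by choice
in `weakDeriv`. -/
theorem hasWeakDeriv_unique (hΩ : IsOpen Ω) {α : Fin d → ℕ} {f g g' : L2 Ω}
    (hg : HasWeakDeriv α f g) (hg' : HasWeakDeriv α f g') : g = g' := by
  rw [← sub_eq_zero]
  have key : ∀ᵐ x ∂(volume.restrict Ω), x ∈ Ω → (g - g') x = 0 := by
    refine hΩ.ae_eq_zero_of_integral_contDiff_smul_eq_zero
      (((Lp.memLp (g - g')).locallyIntegrable (by norm_num)).locallyIntegrableOn Ω) ?_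
    intro φ h1 h2 h3
    have hφ : IsTest Ω φ := ⟨h1, h2, h3⟩
    have hm := hφ.memLp 2 (volume.restrict Ω)
    have e1 := hg φ hφ
    rw [hg' φ hφ, integral_mul_eq_inner g hm, integral_mul_eq_inner g' hm] at e1
    have e2 := mul_left_cancel₀ (pow_ne_zero _ (by norm_num)) e1
    simp only [smul_eq_mul]
    simp_rw [mul_comm (φ _)]
    rw [integral_mul_eq_inner (g - g') hm, inner_sub_right, e2, sub_self]
  apply Lp.ext
  filter_upwards [key, ae_restrict_mem hΩ.measurableSet, Lp.coeFn_zero ℝ 2 (volume.restrict Ω)]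
    with x h1 h2 h3
  rw [h1 h2, h3]; rfl

theorem HasWeakDeriv.weakDeriv_eq (hΩ : IsOpen Ω) {α : Fin d → ℕ} {f g : L2 Ω}
    (hg : HasWeakDeriv α f g) : weakDeriv α f = g := by
  have h : ∃ g : L2 Ω, HasWeakDeriv α f g := ⟨g, hg⟩
  rw [weakDeriv, dif_pos h]
  exact hasWeakDeriv_unique hΩ h.choose_spec hg

theorem weakDeriv_zero_eq (hΩ : IsOpen Ω) (f : L2 Ω) : weakDeriv 0 f = f := by
  refine HasWeakDeriv.weakDeriv_eq hΩ fun φ _ => ?_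
  simp [multiD_zero]

/-- Integration by parts against a fixed `φ` is a closed condition on `(f, G)`, so it passes from
test functions to the closure. -/
theorem hasWeakDeriv_of_mem_closure {f : L2 Ω} {G : Fin d → L2 Ω}
    (h : (f, G) ∈ (testGraph Ω).topologicalClosure) (i : Fin d) :
    HasWeakDeriv (Pi.single i 1) f (G i) := by
  intro φ hφ
  have m1 := (hφ.partialD i).memLp 2 (volume.restrict Ω)
  have m2 := hφ.memLp 2 (volume.restrict Ω)
  rw [multiD_single, integral_mul_eq_inner f m1, integral_mul_eq_inner (G i) m2]
  rw [Finset.sum_pi_single' i 1 Finset.univ]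
  simp only [Finset.mem_univ, if_true, pow_one, neg_mul, one_mul]
  have hcl : IsClosed {x : L2 Ω × (Fin d → L2 Ω) |
      inner ℝ (m1.toLp _) x.1 = -inner ℝ (m2.toLp _) (x.2 i)} := by
    refine isClosed_eq ?_ ?_
    · fun_prop
    · exact (Continuous.inner continuous_const
        ((continuous_apply i).comp continuous_snd)).neg
  have hsub : (testGraph Ω : Set (L2 Ω × (Fin d → L2 Ω))) ⊆ {x : L2 Ω × (Fin d → L2 Ω) |
      inner ℝ (m1.toLp _) x.1 = -inner ℝ (m2.toLp _) (x.2 i)} := by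
    rintro ⟨g, H⟩ ⟨χ, hχ, k1, k2⟩
    simp only [mem_ofPred_eq]
    rw [← integral_mul_eq_inner g m1, ← integral_mul_eq_inner (H i) m2]
    -- The supports lie in `Ω`, so the integrals extend to the whole space and no boundary term
    -- arises.
    have e1 : ∫ x in Ω, g x * VmsPod.partialD i φ x = ∫ x, χ x * VmsPod.partialD i φ x := by
      rw [← setIntegral_eq_integral_of_forall_compl_eq_zero (μ := volume) (s := Ω)
        (f := fun x => χ x * VmsPod.partialD i φ x)]
      · refine integral_congr_ae ?_
        filter_upwards [k1] with x hx
        exact congrArg (· * _) hx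
      · intro x hx
        rw [image_eq_zero_of_notMem_tsupport (fun h => hx (hχ.2.2 h)), zero_mul]
    have e2 : ∫ x in Ω, H i x * φ x = ∫ x, VmsPod.partialD i χ x * φ x := by
      rw [← setIntegral_eq_integral_of_forall_compl_eq_zero (μ := volume) (s := Ω)
        (f := fun x => VmsPod.partialD i χ x * φ x)]
      · refine integral_congr_ae ?_
        filter_upwards [k2 i] with x hx
        exact congrArg (· * _) hx
      · intro x hx
        rw [image_eq_zero_of_notMem_tsupport (fun h => hx (hφ.2.2 h)), mul_zero]
    rw [e1, e2]
    refine integral_mul_fderiv_eq_neg_fderiv_mul_of_integrable ?_ ?_ ?_ ?_ ?_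
    · exact ((hχ.partialD i).memLp 2 volume).integrable_mul (hφ.memLp 2 volume)
    · exact (hχ.memLp 2 volume).integrable_mul ((hφ.partialD i).memLp 2 volume)
    · exact (hχ.memLp 2 volume).integrable_mul (hφ.memLp 2 volume)
    · exact fun x _ => hχ.1.differentiable (by simp) x
    · exact fun x _ => hφ.1.differentiable (by simp) x
  exact closure_minimal hsub hcl h

/-- The source of linearity of `grad` and `divg`: `weakDeriv` takes a default value where no
derivative exists, but on `H10 Ω` its graph lies in a subspace. -/
theorem mem_closure_weakDeriv (hΩ : IsOpen Ω) {f : L2 Ω} (hf : f ∈ H10 Ω) :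
    (f, fun i => weakDeriv (Pi.single i 1) f) ∈ (testGraph Ω).topologicalClosure := by
  obtain ⟨⟨f', G⟩, h, rfl⟩ := hf
  have : (fun i => weakDeriv (Pi.single i 1) f') = G :=
    funext fun i => (hasWeakDeriv_of_mem_closure h i).weakDeriv_eq hΩ
  simp only [LinearMap.fst_apply, this]
  exact h

theorem weakDeriv_add_of_mem (hΩ : IsOpen Ω) {f g : L2 Ω} (hf : f ∈ H10 Ω) (hg : g ∈ H10 Ω)
    (i : Fin d) : weakDeriv (Pi.single i 1) (f + g)
      = weakDeriv (Pi.single i 1) f + weakDeriv (Pi.single i 1) g :=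
  (hasWeakDeriv_of_mem_closure (Submodule.add_mem _ (mem_closure_weakDeriv hΩ hf)
    (mem_closure_weakDeriv hΩ hg)) i).weakDeriv_eq hΩ

theorem weakDeriv_smul_of_mem (hΩ : IsOpen Ω) {f : L2 Ω} (hf : f ∈ H10 Ω) (c : ℝ)
    (i : Fin d) : weakDeriv (Pi.single i 1) (c • f) = c • weakDeriv (Pi.single i 1) f :=
  (hasWeakDeriv_of_mem_closure (Submodule.smul_mem _ c (mem_closure_weakDeriv hΩ hf))
    i).weakDeriv_eq hΩ

/-- The gradient as a linear map on `H_0^1(Ω)^d`. -/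
def gradX (hΩ : IsOpen Ω) : VelX Ω →ₗ[ℝ] L2Mat Ω where
  toFun v := grad (v : L2Vec Ω)
  map_add' v w := by
    ext1 ij
    exact weakDeriv_add_of_mem hΩ (v.2 _) (w.2 _) _
  map_smul' c v := by
    ext1 ij
    exact weakDeriv_smul_of_mem hΩ (v.2 _) c _

/-- The divergence as a linear map on `H_0^1(Ω)^d`. -/
def divX (hΩ : IsOpen Ω) : VelX Ω →ₗ[ℝ] L2 Ω where
  toFun v := divg (v : L2Vec Ω)
  map_add' v w := by
    simp only [divg, ← Finset.sum_add_distrib]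
    exact Finset.sum_congr rfl fun i _ => weakDeriv_add_of_mem hΩ (v.2 _) (w.2 _) _
  map_smul' c v := by
    simp only [divg, RingHom.id_apply, Finset.smul_sum]
    exact Finset.sum_congr rfl fun i _ => weakDeriv_smul_of_mem hΩ (v.2 _) c _

theorem grad_add (hΩ : IsOpen Ω) {u v : L2Vec Ω} (hu : u ∈ VelX Ω) (hv : v ∈ VelX Ω) :
    grad (u + v) = grad u + grad v :=
  (gradX hΩ).map_add ⟨u, hu⟩ ⟨v, hv⟩

theorem grad_sub (hΩ : IsOpen Ω) {u v : L2Vec Ω} (hu : u ∈ VelX Ω) (hv : v ∈ VelX Ω) :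
    grad (u - v) = grad u - grad v :=
  (gradX hΩ).map_sub ⟨u, hu⟩ ⟨v, hv⟩

theorem grad_smul (hΩ : IsOpen Ω) {u : L2Vec Ω} (hu : u ∈ VelX Ω) (c : ℝ) :
    grad (c • u) = c • grad u :=
  (gradX hΩ).map_smul c ⟨u, hu⟩

theorem norm_weakDeriv_le_norm_grad (u : L2Vec Ω) (i j : Fin d) :
    ‖weakDeriv (Pi.single j 1) (u i)‖ ≤ ‖grad u‖ :=
  PiLp.norm_apply_le (grad u) (i, j)

theorem norm_divg_le (u : L2Vec Ω) : ‖divg u‖ ≤ d * ‖grad u‖ := by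
  refine (norm_sum_le _ _).trans ?_
  refine (Finset.sum_le_card_nsmul _ _ ‖grad u‖
    fun i _ => norm_weakDeriv_le_norm_grad u i i).trans ?_
  simp

theorem norm_le_normHVec_one (hΩ : IsOpen Ω) (u : L2Vec Ω) : ‖u‖ ≤ normHVec 1 u := by
  rw [PiLp.norm_eq_of_L2, normHVec]
  refine Real.sqrt_le_sqrt (Finset.sum_le_sum fun i _ => ?_)
  rw [normH, Real.sq_sqrt (Finset.sum_nonneg fun _ _ => sq_nonneg _)]
  have h0 : (0 : Fin d → ℕ) ∈ multiIdx d 1 := by simp [multiIdx]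
  have := Finset.single_le_sum (f := fun α => ‖weakDeriv α (u i)‖ ^ 2)
    (fun α _ => sq_nonneg _) h0
  simpa only [weakDeriv_zero_eq hΩ] using this

end WeakDeriv

/-! ### The Sobolev embedding `H_0^1 ⊆ L^6` and the trilinear form -/

section Sobolev

open scoped ENNReal NNReal
open Filter Topology

variable {d : ℕ} {Ω : Set (EuclideanSpace ℝ (Fin d))}

theorem norm_fderiv_le_sum_partialD (φ : EuclideanSpace ℝ (Fin d) → ℝ)
    (x : EuclideanSpace ℝ (Fin d)) : ‖fderiv ℝ φ x‖ ≤ ∑ i, ‖partialD i φ x‖ := by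
  refine ContinuousLinearMap.opNorm_le_bound _ (Finset.sum_nonneg fun _ _ => norm_nonneg _) ?_
  intro v
  have hv : v = ∑ i, v i • EuclideanSpace.single i (1 : ℝ) := by
    ext j
    simp [Pi.single_apply]
  conv_lhs => rw [hv]
  rw [map_sum, Finset.sum_mul]
  refine (norm_sum_le _ _).trans (Finset.sum_le_sum fun i _ => ?_)
  rw [map_smul, norm_smul, mul_comm]
  exact mul_le_mul_of_nonneg_left (PiLp.norm_apply_le v i) (norm_nonneg _)

theorem eLpNorm_fderiv_le_sum {φ : EuclideanSpace ℝ (Fin d) → ℝ} (hφ : IsTest Ω φ)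
    (μ : Measure (EuclideanSpace ℝ (Fin d))) :
    eLpNorm (fderiv ℝ φ) 2 μ ≤ ∑ i, eLpNorm (partialD i φ) 2 μ := by
  calc eLpNorm (fderiv ℝ φ) 2 μ ≤ eLpNorm (∑ i, fun x => ‖partialD i φ x‖) 2 μ := by
        refine eLpNorm_mono_real fun x => ?_
        simpa using norm_fderiv_le_sum_partialD φ x
    _ ≤ ∑ i, eLpNorm (fun x => ‖partialD i φ x‖) 2 μ :=
        eLpNorm_sum_le (fun i _ => (hφ.partialD i).1.continuous.norm.aestronglyMeasurable)
          (by norm_num)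
    _ = _ := by simp_rw [eLpNorm_norm]

/-- The exponent whose Sobolev conjugate is 6. In the plane `p = 2` is excluded by `p < d`, and `p =
3/2` takes its place. -/
theorem exists_sobolev_exponent (hd : d = 2 ∨ d = 3) : ∃ p : ℝ≥0, 1 ≤ p ∧ p ≤ 2 ∧
    p < (d : ℝ≥0) ∧ (p : ℝ)⁻¹ - (d : ℝ)⁻¹ ≤ 6⁻¹ := by
  rcases hd with rfl | rfl
  · refine ⟨3 / 2, ?_, ?_, ?_, ?_⟩ <;>
      first
      | (rw [← NNReal.coe_le_coe]; push_cast; norm_num)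
      | (rw [← NNReal.coe_lt_coe]; push_cast; norm_num)
      | (push_cast; norm_num)
  · refine ⟨2, ?_, ?_, ?_, ?_⟩ <;> norm_num

theorem eLpNorm_six_le_fderiv_of_exponent (hΩb : Bornology.IsBounded Ω) {p : ℝ≥0} (hp1 : 1 ≤ p)
    (hpd : p < (d : ℝ≥0)) (hpq : (p : ℝ)⁻¹ - (d : ℝ)⁻¹ ≤ 6⁻¹)
    {φ : EuclideanSpace ℝ (Fin d) → ℝ} (hφ : IsTest Ω φ) :
    eLpNorm φ 6 (volume.restrict Ω) ≤ eLpNormLESNormFDerivOfLeConst ℝ volume Ω p 6 *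
      eLpNorm (fderiv ℝ φ) p (volume.restrict Ω) := by
  have hsupp : Function.support φ ⊆ Ω := (subset_tsupport φ).trans hφ.2.2
  have hsupp' : Function.support (fun x => ‖fderiv ℝ φ x‖) ⊆ Ω := by
    intro x hx
    refine hφ.2.2 (support_fderiv_subset ℝ ?_)
    simpa using hx
  have h1 : ContDiff ℝ 1 φ := hφ.1.of_le (by simp)
  have h2 : p < (Module.finrank ℝ (EuclideanSpace ℝ (Fin d)) : ℝ≥0) := by
    rwa [finrank_euclideanSpace_fin]
  have h3 : (p : ℝ)⁻¹ - (Module.finrank ℝ (EuclideanSpace ℝ (Fin d)) : ℝ)⁻¹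
      ≤ (((6 : ℝ≥0)) : ℝ)⁻¹ := by
    rw [finrank_euclideanSpace_fin, NNReal.coe_ofNat]
    exact hpq
  have key := eLpNorm_le_eLpNorm_fderiv_of_le volume h1 hsupp hp1 h2 h3 hΩb
  rw [ENNReal.coe_ofNat] at key
  rw [eLpNorm_restrict_eq_of_support_subset hsupp, ← eLpNorm_norm (fderiv ℝ φ),
    eLpNorm_restrict_eq_of_support_subset hsupp', eLpNorm_norm]
  exact key

theorem exists_eLpNorm_six_le_fderiv (hd : d = 2 ∨ d = 3) (hΩb : Bornology.IsBounded Ω) :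
    ∃ C : ℝ≥0, ∀ φ : EuclideanSpace ℝ (Fin d) → ℝ, IsTest Ω φ →
      eLpNorm φ 6 (volume.restrict Ω) ≤ C * eLpNorm (fderiv ℝ φ) 2 (volume.restrict Ω) := by
  obtain ⟨p, hp1, hp2, hpd, hpq⟩ := exists_sobolev_exponent hd
  have hfin : volume Ω ≠ ⊤ := hΩb.measure_lt_top.ne
  obtain ⟨e, he⟩ : ∃ e : ℝ, e = 1 / (p : ℝ≥0∞).toReal - 1 / (2 : ℝ≥0∞).toReal := ⟨_, rfl⟩
  have he0 : 0 ≤ e := by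
    have h1 : (0 : ℝ) < p := by exact_mod_cast lt_of_lt_of_le one_pos hp1
    have h2 : (p : ℝ) ≤ 2 := by exact_mod_cast hp2
    simp only [he, ENNReal.coe_toReal, ENNReal.toReal_ofNat, sub_nonneg]
    exact one_div_le_one_div_of_le h1 h2
  have hvfin : volume Ω ^ e ≠ ⊤ := ENNReal.rpow_ne_top_of_nonneg he0 hfin
  obtain ⟨C, hC⟩ : ∃ C : ℝ≥0, C = eLpNormLESNormFDerivOfLeConst (E := EuclideanSpace ℝ (Fin d))
    ℝ volume Ω p 6 := ⟨_, rfl⟩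
  refine ⟨C * (volume Ω ^ e).toNNReal, fun φ hφ => ?_⟩
  have key := eLpNorm_six_le_fderiv_of_exponent hΩb hp1 hpd hpq hφ
  -- Boundedness of `Ω` allows the exponent `p` on the gradient to be raised to 2.
  have h2 := eLpNorm_le_eLpNorm_mul_rpow_measure_univ (μ := volume.restrict Ω)
    (p := (p : ℝ≥0∞)) (q := 2) (f := fderiv ℝ φ) (by exact_mod_cast hp2)
    (hφ.1.continuous_fderiv (by simp)).aestronglyMeasurable
  rw [Measure.restrict_apply_univ, ← he] at h2
  rw [← hC] at key
  refine (le_trans key (mul_le_mul_right h2 _)).trans (le_of_eq ?_)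
  rw [ENNReal.coe_mul, ENNReal.coe_toNNReal hvfin]
  ring

/-- The `L^6` norm is only lower semicontinuous under `L²` convergence: Fatou along an almost
everywhere convergent subsequence. -/
theorem eLpNorm_six_le_of_tendsto {C : ℝ≥0∞} {g : ℕ → L2 Ω × (Fin d → L2 Ω)}
    {x : L2 Ω × (Fin d → L2 Ω)} (hg : Tendsto g atTop (𝓝 x))
    (hC : ∀ n, eLpNorm (g n).1 6 (volume.restrict Ω) ≤ C * ∑ i, ‖(g n).2 i‖ₑ)
    (hCfin : C ≠ ⊤) :
    eLpNorm x.1 6 (volume.restrict Ω) ≤ C * ∑ i, ‖x.2 i‖ₑ := by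
  have h1 : Tendsto (fun n => (g n).1) atTop (𝓝 x.1) := (continuous_fst.tendsto x).comp hg
  obtain ⟨ns, hns, hae⟩ := (tendstoInMeasure_of_tendsto_Lp h1).exists_seq_tendsto_ae
  have h2 : Tendsto (fun n => C * ∑ i, ‖(g (ns n)).2 i‖ₑ) atTop (𝓝 (C * ∑ i, ‖x.2 i‖ₑ)) := by
    refine ENNReal.Tendsto.const_mul ?_ (Or.inr hCfin)
    refine tendsto_finsetSum _ fun i _ => ?_
    exact (((continuous_apply i).comp continuous_snd).enorm.tendsto x).comp
      (hg.comp hns.tendsto_atTop)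
  calc eLpNorm x.1 6 (volume.restrict Ω)
      ≤ liminf (fun n => eLpNorm (g (ns n)).1 6 (volume.restrict Ω)) atTop :=
        Lp.eLpNorm_lim_le_liminf_eLpNorm (fun n => Lp.aestronglyMeasurable _) _ hae
    _ ≤ liminf (fun n => C * ∑ i, ‖(g (ns n)).2 i‖ₑ) atTop :=
        liminf_le_liminf (Eventually.of_forall fun n => hC (ns n))
    _ = _ := h2.liminf_eq

theorem exists_eLpNorm_six_le (hd : d = 2 ∨ d = 3) (hΩ : IsOpen Ω)
    (hΩb : Bornology.IsBounded Ω) :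
    ∃ C : ℝ≥0, ∀ u : L2Vec Ω, u ∈ VelX Ω → ∀ i,
      eLpNorm (u i) 6 (volume.restrict Ω) ≤ ENNReal.ofReal (C * ‖grad u‖) := by
  obtain ⟨C, hC⟩ := exists_eLpNorm_six_le_fderiv hd hΩb
  refine ⟨C * d, fun u hu i => ?_⟩
  have hcl := mem_closure_weakDeriv hΩ (hu i)
  rw [← SetLike.mem_coe, Submodule.topologicalClosure_coe, mem_closure_iff_seq_limit] at hcl
  obtain ⟨g, hg, hlim⟩ := hcl
  have h := eLpNorm_six_le_of_tendsto (C := (C : ℝ≥0∞)) hlim ?_ ENNReal.coe_ne_top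
  · refine h.trans ?_
    have h3 : ∑ j, ‖weakDeriv (Pi.single j 1) (u i)‖ₑ ≤ d * ENNReal.ofReal ‖grad u‖ := by
      refine (Finset.sum_le_card_nsmul _ _ (ENNReal.ofReal ‖grad u‖) fun j _ => ?_).trans ?_
      · rw [← ofReal_norm]
        exact ENNReal.ofReal_le_ofReal (norm_weakDeriv_le_norm_grad u i j)
      · simp
    refine (mul_le_mul_right h3 _).trans (le_of_eq ?_)
    rw [ENNReal.ofReal_mul (by positivity)]
    push_cast
    rw [ENNReal.ofReal_mul (by positivity), ENNReal.ofReal_coe_nnreal, ENNReal.ofReal_natCast,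
      mul_assoc]
  · intro n
    obtain ⟨φ, hφ, h1, h2⟩ := hg n
    rw [eLpNorm_congr_ae h1]
    refine (hC φ hφ).trans (mul_le_mul_right ((eLpNorm_fderiv_le_sum hφ _).trans ?_) _)
    refine Finset.sum_le_sum fun j _ => ?_
    rw [Lp.enorm_def, eLpNorm_congr_ae (h2 j)]

/-- The Poincaré inequality comes from the `L^6` embedding, because `L^6 ⊆ L²` on a set of finite
measure. -/
theorem exists_norm_le_norm_grad (hd : d = 2 ∨ d = 3) (hΩ : IsOpen Ω)
    (hΩb : Bornology.IsBounded Ω) :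
    ∃ C : ℝ, 0 ≤ C ∧ ∀ u : L2Vec Ω, u ∈ VelX Ω → ‖u‖ ≤ C * ‖grad u‖ := by
  obtain ⟨C, hC⟩ := exists_eLpNorm_six_le hd hΩ hΩb
  have hfin : volume Ω ≠ ⊤ := hΩb.measure_lt_top.ne
  set e : ℝ := 1 / (2 : ℝ≥0∞).toReal - 1 / (6 : ℝ≥0∞).toReal with he
  have he0 : 0 ≤ e := by norm_num [he]
  have hvfin : volume Ω ^ e ≠ ⊤ := ENNReal.rpow_ne_top_of_nonneg he0 hfin
  refine ⟨d * (C * (volume Ω ^ e).toReal), by positivity, fun u hu => ?_⟩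
  have hi (i) : ‖u i‖ ≤ C * (volume Ω ^ e).toReal * ‖grad u‖ := by
    have h2 := eLpNorm_le_eLpNorm_mul_rpow_measure_univ (μ := volume.restrict Ω)
      (p := 2) (q := 6) (f := u i) (by norm_num) (Lp.aestronglyMeasurable _)
    rw [Measure.restrict_apply_univ] at h2
    have h3 := h2.trans (mul_le_mul_left (hC u hu i) _)
    rw [Lp.norm_def]
    refine (ENNReal.toReal_mono (ENNReal.mul_ne_top ENNReal.ofReal_ne_top hvfin) h3).trans ?_
    rw [ENNReal.toReal_mul, ENNReal.toReal_ofReal (by positivity)]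
    exact le_of_eq (by ring)
  have hsum : ‖u‖ ≤ ∑ i, ‖u i‖ := by
    rw [PiLp.norm_eq_of_L2]
    refine Real.sqrt_le_iff.2 ⟨Finset.sum_nonneg fun _ _ => norm_nonneg _, ?_⟩
    exact Finset.sum_sq_le_sq_sum_of_nonneg fun _ _ => norm_nonneg _
  refine hsum.trans ((Finset.sum_le_card_nsmul _ _ _ fun i _ => hi i).trans (le_of_eq ?_))
  simp
  ring

end Sobolev

/-! ### Hölder bounds for the convective form -/

section Trilinear

open scoped ENNReal NNReal

/-- Hölder with weights `1/6 + 1/2 + 1/4 + 1/12 = 1`, after writing `|c| = (|c|²)^{1/4}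
(|c|^6)^{1/12}`. This contains the interpolation of `L^3` between `L²` and `L^6`. -/
theorem lintegral_enorm_mul_mul_le {α : Type*} [MeasurableSpace α] {μ : Measure α}
    {a g c : α → ℝ} (ha : AEStronglyMeasurable a μ) (hg : AEStronglyMeasurable g μ)
    (hc : AEStronglyMeasurable c μ) :
    ∫⁻ x, ‖a x * g x * c x‖ₑ ∂μ ≤ eLpNorm a 6 μ * eLpNorm g 2 μ *
      (eLpNorm c 2 μ ^ (1 / 2 : ℝ) * eLpNorm c 6 μ ^ (1 / 2 : ℝ)) := by
  have key := ENNReal.lintegral_prod_norm_pow_le (μ := μ) (Finset.univ : Finset (Fin 4))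
    (f := ![fun x => ‖a x‖ₑ ^ (6 : ℝ), fun x => ‖g x‖ₑ ^ (2 : ℝ), fun x => ‖c x‖ₑ ^ (2 : ℝ),
      fun x => ‖c x‖ₑ ^ (6 : ℝ)]) (p := ![1 / 6, 1 / 2, 1 / 4, 1 / 12])
    (by
      intro i _
      fin_cases i
      · exact ha.enorm.pow_const _
      · exact hg.enorm.pow_const _
      · exact hc.enorm.pow_const _
      · exact hc.enorm.pow_const _)
    (by simp [Fin.sum_univ_four]; norm_num)
    (by intro i _; fin_cases i <;> simp)
  simp only [Fin.prod_univ_four, Matrix.cons_val] at key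
  have e6 (f : α → ℝ) : eLpNorm f 6 μ = (∫⁻ x, ‖f x‖ₑ ^ (6 : ℝ) ∂μ) ^ (1 / 6 : ℝ) := by
    rw [eLpNorm_eq_lintegral_rpow_enorm_toReal (by norm_num) (by norm_num)]
    simp
  have e2 (f : α → ℝ) : eLpNorm f 2 μ = (∫⁻ x, ‖f x‖ₑ ^ (2 : ℝ) ∂μ) ^ (1 / 2 : ℝ) := by
    rw [eLpNorm_eq_lintegral_rpow_enorm_toReal (by norm_num) (by norm_num)]
    simp
  rw [e6 a, e2 g, e2 c, e6 c, ← ENNReal.rpow_mul, ← ENNReal.rpow_mul, ← mul_assoc]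
  norm_num only at key ⊢
  refine le_trans (le_of_eq (lintegral_congr fun x => ?_)) key
  rw [← ENNReal.rpow_mul, ← ENNReal.rpow_mul, ← ENNReal.rpow_mul, ← ENNReal.rpow_mul,
    enorm_mul, enorm_mul, mul_assoc (_ * _),
    ← ENNReal.rpow_add_of_nonneg _ _ (by norm_num) (by norm_num)]
  norm_num

variable {d : ℕ} {Ω : Set (EuclideanSpace ℝ (Fin d))}

theorem integrable_mul_mul_and_abs_integral_le {a g c : L2 Ω} {A B : ℝ} (hA : 0 ≤ A) (hB : 0 ≤ B)
    (ha : eLpNorm a 6 (volume.restrict Ω) ≤ ENNReal.ofReal A)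
    (hc : eLpNorm c 6 (volume.restrict Ω) ≤ ENNReal.ofReal B) :
    Integrable (fun x => a x * g x * c x) (volume.restrict Ω) ∧
      |∫ x in Ω, a x * g x * c x| ≤ A * ‖g‖ * (√‖c‖ * √B) := by
  have h1 := lintegral_enorm_mul_mul_le (Lp.aestronglyMeasurable a) (Lp.aestronglyMeasurable g)
    (Lp.aestronglyMeasurable c)
  have h2 : ∫⁻ x in Ω, ‖a x * g x * c x‖ₑ ≤ ENNReal.ofReal (A * ‖g‖ * (√‖c‖ * √B)) := by
    refine h1.trans ?_
    rw [ENNReal.ofReal_mul (by positivity), ENNReal.ofReal_mul (by positivity),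
      ENNReal.ofReal_mul (by positivity), ← Lp.enorm_def, ← Lp.enorm_def, ofReal_norm,
      Real.sqrt_eq_rpow, Real.sqrt_eq_rpow,
      ← ENNReal.ofReal_rpow_of_nonneg (norm_nonneg _) (by norm_num),
      ← ENNReal.ofReal_rpow_of_nonneg hB (by norm_num), ofReal_norm]
    gcongr
  refine ⟨⟨((Lp.aestronglyMeasurable a).mul (Lp.aestronglyMeasurable g)).mul
    (Lp.aestronglyMeasurable c), lt_of_le_of_lt h2 ENNReal.ofReal_lt_top⟩, ?_⟩
  rw [← Real.norm_eq_abs, ← ENNReal.ofReal_le_ofReal_iff (by positivity), ofReal_norm]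
  exact (enorm_integral_le_lintegral_enorm _).trans h2

/-- The embedding `H_0^1(Ω)^d ⊆ L^6(Ω)^d` with constant `C`. -/
def SobolevSix (Ω : Set (EuclideanSpace ℝ (Fin d))) (C : ℝ≥0) : Prop :=
  ∀ u : L2Vec Ω, u ∈ VelX Ω → ∀ i,
      eLpNorm (u i) 6 (volume.restrict Ω) ≤ ENNReal.ofReal (C * ‖grad u‖)

theorem SobolevSix.integrable {C : ℝ≥0} (hC : SobolevSix Ω C) {u w : L2Vec Ω}
    (hu : u ∈ VelX Ω) (hw : w ∈ VelX Ω) (g : L2 Ω) (i j : Fin d) :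
    Integrable (fun x => u j x * g x * w i x) (volume.restrict Ω) :=
  (integrable_mul_mul_and_abs_integral_le (by positivity) (by positivity)
    (hC u hu j) (hC w hw i)).1

theorem SobolevSix.conv_eq {C : ℝ≥0} (hC : SobolevSix Ω C) {u w : L2Vec Ω}
    (hu : u ∈ VelX Ω) (hw : w ∈ VelX Ω) (v : L2Vec Ω) :
    conv u v w = ∑ i, ∑ j, ∫ x in Ω, u j x * grad v (i, j) x * w i x := by
  rw [conv, integral_finsetSum _ fun i _ => integrable_finsetSum _ fun j _ =>
    hC.integrable hu hw _ i j]
  exact Finset.sum_congr rfl fun i _ => integral_finsetSum _ fun j _ =>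
    hC.integrable hu hw _ i j

theorem SobolevSix.abs_conv_le {C : ℝ≥0} (hC : SobolevSix Ω C) {u w : L2Vec Ω}
    (hu : u ∈ VelX Ω) (hw : w ∈ VelX Ω) (v : L2Vec Ω) :
    |conv u v w| ≤ d ^ 2 * (C * √C) * (‖grad u‖ * ‖grad v‖ * (√‖w‖ * √‖grad w‖)) := by
  have hij (i j : Fin d) : |∫ x in Ω, u j x * grad v (i, j) x * w i x|
      ≤ (C * √C) * (‖grad u‖ * ‖grad v‖ * (√‖w‖ * √‖grad w‖)) := by
    refine (integrable_mul_mul_and_abs_integral_le (by positivity) (by positivity)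
      (hC u hu j) (hC w hw i)).2.trans ?_
    rw [Real.sqrt_mul (by positivity)]
    have h1 : ‖grad v (i, j)‖ ≤ ‖grad v‖ := PiLp.norm_apply_le (grad v) (i, j)
    have h2 : √‖w i‖ ≤ √‖w‖ := Real.sqrt_le_sqrt (PiLp.norm_apply_le w i)
    calc _ ≤ C * ‖grad u‖ * ‖grad v‖ * (√‖w‖ * (√C * √‖grad w‖)) := by gcongr
      _ = _ := by ring
  rw [hC.conv_eq hu hw]
  refine (Finset.abs_sum_le_sum_abs _ _).trans ?_
  refine (Finset.sum_le_sum fun i _ => (Finset.abs_sum_le_sum_abs _ _).trans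
    (Finset.sum_le_sum fun j _ => hij i j)).trans (le_of_eq ?_)
  simp
  ring

/-- The half powers now fall on the transporting field. The skew form `triB v u v` contains `conv v
v u`, where `v` occupies that slot and not the last. -/
theorem SobolevSix.abs_conv_le' {C : ℝ≥0} (hC : SobolevSix Ω C) {u w : L2Vec Ω}
    (hu : u ∈ VelX Ω) (hw : w ∈ VelX Ω) (v : L2Vec Ω) :
    |conv u v w| ≤ d ^ 2 * (C * √C) * (‖grad w‖ * ‖grad v‖ * (√‖u‖ * √‖grad u‖)) := by
  have hij (i j : Fin d) : |∫ x in Ω, u j x * grad v (i, j) x * w i x|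
      ≤ (C * √C) * (‖grad w‖ * ‖grad v‖ * (√‖u‖ * √‖grad u‖)) := by
    have hcomm : ∫ x in Ω, u j x * grad v (i, j) x * w i x
        = ∫ x in Ω, w i x * grad v (i, j) x * u j x := by
      congr 1; funext x; ring
    rw [hcomm]
    refine (integrable_mul_mul_and_abs_integral_le (by positivity) (by positivity)
      (hC w hw i) (hC u hu j)).2.trans ?_
    rw [Real.sqrt_mul (by positivity)]
    have h1 : ‖grad v (i, j)‖ ≤ ‖grad v‖ := PiLp.norm_apply_le (grad v) (i, j)
    have h2 : √‖u j‖ ≤ √‖u‖ := Real.sqrt_le_sqrt (PiLp.norm_apply_le u j)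
    calc _ ≤ C * ‖grad w‖ * ‖grad v‖ * (√‖u‖ * (√C * √‖grad u‖)) := by gcongr
      _ = _ := by ring
  rw [hC.conv_eq hu hw]
  refine (Finset.abs_sum_le_sum_abs _ _).trans ?_
  refine (Finset.sum_le_sum fun i _ => (Finset.abs_sum_le_sum_abs _ _).trans
    (Finset.sum_le_sum fun j _ => hij i j)).trans (le_of_eq ?_)
  simp
  ring

theorem SobolevSix.conv_sub_left {C : ℝ≥0} (hC : SobolevSix Ω C) {u u' w : L2Vec Ω}
    (hu : u ∈ VelX Ω) (hu' : u' ∈ VelX Ω) (hw : w ∈ VelX Ω) (v : L2Vec Ω) :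
    conv (u - u') v w = conv u v w - conv u' v w := by
  rw [hC.conv_eq hu hw, hC.conv_eq hu' hw, hC.conv_eq (Submodule.sub_mem _ hu hu') hw]
  simp only [← Finset.sum_sub_distrib]
  refine Finset.sum_congr rfl fun i _ => Finset.sum_congr rfl fun j _ => ?_
  rw [← integral_sub (hC.integrable hu hw _ i j) (hC.integrable hu' hw _ i j)]
  refine integral_congr_ae ?_
  filter_upwards [Lp.coeFn_sub (u j) (u' j)] with x hx
  rw [PiLp.sub_apply, hx, Pi.sub_apply]
  ring

theorem SobolevSix.conv_sub_right {C : ℝ≥0} (hC : SobolevSix Ω C) {u w w' : L2Vec Ω}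
    (hu : u ∈ VelX Ω) (hw : w ∈ VelX Ω) (hw' : w' ∈ VelX Ω) (v : L2Vec Ω) :
    conv u v (w - w') = conv u v w - conv u v w' := by
  rw [hC.conv_eq hu hw, hC.conv_eq hu hw', hC.conv_eq hu (Submodule.sub_mem _ hw hw')]
  simp only [← Finset.sum_sub_distrib]
  refine Finset.sum_congr rfl fun i _ => Finset.sum_congr rfl fun j _ => ?_
  rw [← integral_sub (hC.integrable hu hw _ i j) (hC.integrable hu hw' _ i j)]
  refine integral_congr_ae ?_
  filter_upwards [Lp.coeFn_sub (w i) (w' i)] with x hx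
  rw [PiLp.sub_apply, hx, Pi.sub_apply]
  ring

theorem SobolevSix.conv_sub_mid {C : ℝ≥0} (hC : SobolevSix Ω C) (hΩ : IsOpen Ω)
    {u v v' w : L2Vec Ω} (hu : u ∈ VelX Ω) (hv : v ∈ VelX Ω) (hv' : v' ∈ VelX Ω)
    (hw : w ∈ VelX Ω) :
    conv u (v - v') w = conv u v w - conv u v' w := by
  rw [hC.conv_eq hu hw, hC.conv_eq hu hw, hC.conv_eq hu hw, grad_sub hΩ hv hv']
  simp only [← Finset.sum_sub_distrib]
  refine Finset.sum_congr rfl fun i _ => Finset.sum_congr rfl fun j _ => ?_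
  rw [← integral_sub (hC.integrable hu hw _ i j) (hC.integrable hu hw _ i j)]
  refine integral_congr_ae ?_
  filter_upwards [Lp.coeFn_sub (grad v (i, j)) (grad v' (i, j))] with x hx
  rw [PiLp.sub_apply, hx, Pi.sub_apply]
  ring

theorem triB_self (u v : L2Vec Ω) : triB u v v = 0 := by simp [triB]

theorem SobolevSix.triB_sub_left {C : ℝ≥0} (hC : SobolevSix Ω C) {u u' v w : L2Vec Ω}
    (hu : u ∈ VelX Ω) (hu' : u' ∈ VelX Ω) (hv : v ∈ VelX Ω) (hw : w ∈ VelX Ω) :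
    triB (u - u') v w = triB u v w - triB u' v w := by
  simp only [triB, hC.conv_sub_left hu hu' hw, hC.conv_sub_left hu hu' hv]
  ring

theorem SobolevSix.triB_sub_mid {C : ℝ≥0} (hC : SobolevSix Ω C) (hΩ : IsOpen Ω)
    {u v v' w : L2Vec Ω} (hu : u ∈ VelX Ω) (hv : v ∈ VelX Ω) (hv' : v' ∈ VelX Ω)
    (hw : w ∈ VelX Ω) : triB u (v - v') w = triB u v w - triB u v' w := by
  simp only [triB, hC.conv_sub_mid hΩ hu hv hv' hw, hC.conv_sub_right hu hv hv']
  ring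

/-- Skew symmetry removes `triB w φ φ`, so `w` survives only next to the projection error `η`. -/
theorem SobolevSix.triB_sub_triB {C : ℝ≥0} (hC : SobolevSix Ω C) (hΩ : IsOpen Ω)
    {u w η φ : L2Vec Ω} (hu : u ∈ VelX Ω) (hw : w ∈ VelX Ω) (hη : η ∈ VelX Ω) (hφ : φ ∈ VelX Ω)
    (h : u - w = η - φ) :
    triB u u φ - triB w w φ = triB η u φ - triB φ u φ + triB w η φ := by
  have h1 := hC.triB_sub_left hu hw hu hφ
  have h2 := hC.triB_sub_mid hΩ hw hu hw hφ
  rw [h, hC.triB_sub_left hη hφ hu hφ] at h1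
  rw [h, hC.triB_sub_mid hΩ hw hη hφ hφ, triB_self] at h2
  linarith

/-- The constants of the Sobolev and Poincaré inequalities combine to a bound of the trilinear
form. -/
theorem exists_abs_triB_le (hd : d = 2 ∨ d = 3) (hΩ : IsOpen Ω) (hΩb : Bornology.IsBounded Ω) :
    ∃ C : ℝ≥0, SobolevSix Ω C ∧ ∃ c : ℝ, 0 ≤ c ∧
      (∀ u : L2Vec Ω, u ∈ VelX Ω → ‖u‖ ≤ c * ‖grad u‖) ∧
      (∀ u v w : L2Vec Ω, u ∈ VelX Ω → v ∈ VelX Ω → w ∈ VelX Ω →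
        |triB u v w| ≤ c * (‖grad u‖ * ‖grad v‖ * ‖grad w‖)) ∧
      (∀ u v : L2Vec Ω, u ∈ VelX Ω → v ∈ VelX Ω →
        |triB v u v| ≤ c * (‖grad u‖ * (√‖v‖ * √‖grad v‖ ^ 3))) := by
  obtain ⟨C, hC⟩ := exists_eLpNorm_six_le hd hΩ hΩb
  obtain ⟨P, hP0, hP⟩ := exists_norm_le_norm_grad hd hΩ hΩb
  replace hC : SobolevSix Ω C := hC
  set k : ℝ := d ^ 2 * (C * √C) with hk
  have hk0 : 0 ≤ k := by positivity
  have hcv (u v w : L2Vec Ω) (hu : u ∈ VelX Ω) (hw : w ∈ VelX Ω) :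
      |conv u v w| ≤ k * √P * (‖grad u‖ * ‖grad v‖ * ‖grad w‖) := by
    refine (hC.abs_conv_le hu hw v).trans ?_
    have h1 : √‖w‖ ≤ √P * √‖grad w‖ := by
      rw [← Real.sqrt_mul hP0]
      exact Real.sqrt_le_sqrt (hP w hw)
    calc _ ≤ k * (‖grad u‖ * ‖grad v‖ * ((√P * √‖grad w‖) * √‖grad w‖)) := by gcongr
      _ = k * √P * (‖grad u‖ * ‖grad v‖ * (√‖grad w‖ * √‖grad w‖)) := by ring
      _ = _ := by rw [Real.mul_self_sqrt (norm_nonneg _)]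
  refine ⟨C, hC, P + k * √P + k, by positivity, fun u hu => ?_, fun u v w hu hv hw => ?_,
    fun u v hu hv => ?_⟩
  · refine (hP u hu).trans ?_
    gcongr
    have : 0 ≤ k * √P + k := by positivity
    linarith
  · have h1 := hcv u v w hu hw
    have h2 := hcv u w v hu hv
    have h3 : |triB u v w| ≤ k * √P * (‖grad u‖ * ‖grad v‖ * ‖grad w‖) := by
      rw [triB, abs_mul, abs_of_pos (by norm_num : (0 : ℝ) < 1 / 2)]
      have := abs_sub (conv u v w) (conv u w v)
      rw [mul_right_comm ‖grad u‖] at h2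
      linarith
    refine h3.trans ?_
    gcongr
    linarith
  · have h1 := hC.abs_conv_le hv hv u
    have h2 := hC.abs_conv_le' hv hu v
    have h4 : ‖grad v‖ * √‖grad v‖ = √‖grad v‖ ^ 3 := by
      nth_rewrite 1 [← Real.mul_self_sqrt (norm_nonneg (grad v))]
      ring
    have e1 : ‖grad v‖ * ‖grad u‖ * (√‖v‖ * √‖grad v‖)
        = ‖grad u‖ * (√‖v‖ * √‖grad v‖ ^ 3) := by rw [← h4]; ring
    have e2 : ‖grad u‖ * ‖grad v‖ * (√‖v‖ * √‖grad v‖)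
        = ‖grad u‖ * (√‖v‖ * √‖grad v‖ ^ 3) := by rw [← h4]; ring
    rw [← hk, e1] at h1
    rw [← hk, e2] at h2
    have h3 : |triB v u v| ≤ k * (‖grad u‖ * (√‖v‖ * √‖grad v‖ ^ 3)) := by
      rw [triB, abs_mul, abs_of_pos (by norm_num : (0 : ℝ) < 1 / 2)]
      have := abs_sub (conv v u v) (conv v v u)
      linarith
    refine h3.trans ?_
    gcongr
    have : 0 ≤ k * √P := by positivity
    linarith

end Trilinear

/-! ### POD modes, the inverse inequality and the projections -/

section POD

variable {d : ℕ} {Ω : Set (EuclideanSpace ℝ (Fin d))} {M N : ℕ} {y : Fin M → L2Vec Ω}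
  {ψ : ℕ → L2Vec Ω} {lam : ℕ → ℝ}

theorem IsPODBasis.orthonormal (h : IsPODBasis y N ψ lam) (hM : 0 < M) {s : ℕ} (hs : s ≤ N) :
    Orthonormal ℝ fun j : Fin s => ψ j := by
  obtain ⟨v, hv, hev⟩ := h.eigen
  have hM' : (0 : ℝ) < M := by exact_mod_cast hM
  have hN : Orthonormal ℝ fun j : Fin N => ψ j := by
    rw [orthonormal_iff_ite] at hv ⊢
    intro i j
    -- The Gram matrix of the snapshots is `M` times `corrMatrix y`, so the eigenvalue equation
    -- collapses the double sum.
    have hsum : inner ℝ (∑ k, v i k • y k) (∑ l, v j l • y l)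
        = M * (lam j * inner ℝ (v i) (v j)) := by
      have hy (k l : Fin M) : inner ℝ (y k) (y l) = M * corrMatrix y k l := by
        simp only [corrMatrix, Matrix.of_apply]
        field_simp
      have hK (k : Fin M) : ∑ l, corrMatrix y k l * v j l = lam j * v j k := by
        have := congrFun (hev j).1 k
        simpa [Matrix.mulVec, dotProduct] using this
      calc inner ℝ (∑ k, v i k • y k) (∑ l, v j l • y l)
          = ∑ k, v i k * (M * ∑ l, corrMatrix y k l * v j l) := by
            rw [sum_inner]
            refine Finset.sum_congr rfl fun k _ => ?_
            rw [real_inner_smul_left, inner_sum]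
            congr 1
            rw [Finset.mul_sum]
            refine Finset.sum_congr rfl fun l _ => ?_
            rw [real_inner_smul_right, hy]
            ring
        _ = M * (lam j * inner ℝ (v i) (v j)) := by
            simp only [hK, PiLp.inner_apply, Finset.mul_sum]
            refine Finset.sum_congr rfl fun k _ => ?_
            simp only [RCLike.inner_apply, conj_trivial]
            ring
    rw [(hev i).2, (hev j).2, real_inner_smul_left, real_inner_smul_right, hsum, hv i j]
    split_ifs with hij
    · subst hij
      have hl : 0 < M * lam i := mul_pos hM' (h.lam_pos i i.2)
      have h2 : √(M * lam i) ≠ 0 := (Real.sqrt_pos.2 hl).ne'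
      have h3 : M * lam i = √(M * lam i) * √(M * lam i) := (Real.mul_self_sqrt hl.le).symm
      rw [mul_one, h3, Real.sqrt_mul_self (Real.sqrt_nonneg _)]
      field_simp
    · simp
  exact hN.comp (Fin.castLE hs) (Fin.castLE_injective hs)

/-- Through this inclusion the modes inherit boundary values and discrete incompressibility from the
snapshots. -/
theorem IsPODBasis.podSpace_le (h : IsPODBasis y N ψ lam) {s : ℕ} (hs : s ≤ N) :
    podSpace ψ s ≤ Submodule.span ℝ (Set.range y) := by
  obtain ⟨v, -, hev⟩ := h.eigen
  refine Submodule.span_le.2 ?_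
  rintro _ ⟨j, rfl⟩
  have := (hev ⟨j, j.2.trans_le hs⟩).2
  simp only at this
  simp only [SetLike.mem_coe]
  rw [this]
  exact Submodule.smul_mem _ _ (Submodule.sum_mem _ fun k _ =>
    Submodule.smul_mem _ _ (Submodule.subset_span ⟨k, rfl⟩))

/-- The inverse inequality: in coordinates `a` for the orthonormal modes, `‖φ‖ = |a|` and `‖∇φ‖²` is
the quadratic form of the stiffness matrix. -/
theorem norm_grad_sq_le_stiffNorm_mul (hΩ : IsOpen Ω) {s : ℕ}
    (ho : Orthonormal ℝ fun j : Fin s => ψ j) (hX : podSpace ψ s ≤ VelX Ω) {φ : L2Vec Ω}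
    (hφ : φ ∈ podSpace ψ s) : ‖grad φ‖ ^ 2 ≤ stiffNorm ψ s * ‖φ‖ ^ 2 := by
  obtain ⟨a, rfl⟩ := (Submodule.mem_span_range_iff_exists_fun ℝ).1 hφ
  have hmem (j : Fin s) : ψ j ∈ VelX Ω := hX (Submodule.subset_span ⟨j, rfl⟩)
  have hgrad : grad (∑ j, a j • ψ j) = ∑ j, a j • grad (ψ j) := by
    have := map_sum (gradX hΩ) (fun j : Fin s => a j • (⟨ψ j, hmem j⟩ : VelX Ω)) Finset.univ
    simp only [map_smul] at this
    have h2 : ((∑ j : Fin s, a j • (⟨ψ j, hmem j⟩ : VelX Ω) : VelX Ω) : L2Vec Ω)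
        = ∑ j, a j • ψ j := by simp
    rw [← h2]
    exact this
  have hnorm : ‖∑ j, a j • ψ j‖ ^ 2 = ‖WithLp.toLp 2 a‖ ^ 2 := by
    rw [← real_inner_self_eq_norm_sq, ho.inner_sum, EuclideanSpace.norm_sq_eq]
    refine Finset.sum_congr rfl fun i _ => ?_
    simp [sq]
  have hS : ‖∑ j, a j • grad (ψ j)‖ ^ 2 = inner ℝ (WithLp.toLp 2 a)
      (Matrix.toEuclideanCLM (𝕜 := ℝ) (stiffness ψ s) (WithLp.toLp 2 a)) := by
    rw [← real_inner_self_eq_norm_sq, sum_inner, Matrix.toEuclideanCLM_toLp, PiLp.inner_apply]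
    refine Finset.sum_congr rfl fun i _ => ?_
    rw [real_inner_smul_left, inner_sum]
    simp only [RCLike.inner_apply, conj_trivial, Matrix.mulVec, dotProduct, stiffness,
      Matrix.of_apply]
    rw [mul_comm]
    congr 1
    refine Finset.sum_congr rfl fun j _ => ?_
    rw [real_inner_smul_right, real_inner_comm]
    ring
  rw [hgrad, hnorm, hS]
  refine (real_inner_le_norm _ _).trans ?_
  rw [mul_comm, sq, ← mul_assoc]
  exact mul_le_mul_of_nonneg_right (ContinuousLinearMap.le_opNorm _ _) (norm_nonneg _)

theorem grad_mem_podGradSpace (hΩ : IsOpen Ω) {s : ℕ} (hX : podSpace ψ s ≤ VelX Ω)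
    {φ : L2Vec Ω} (hφ : φ ∈ podSpace ψ s) : grad φ ∈ podGradSpace ψ s := by
  refine Submodule.span_induction (p := fun φ _ => grad φ ∈ podGradSpace ψ s) ?_ ?_ ?_ ?_ hφ
  · rintro _ ⟨j, rfl⟩
    exact Submodule.subset_span ⟨j, rfl⟩
  · have : grad (0 : L2Vec Ω) = 0 := (gradX hΩ).map_zero
    rw [this]
    exact Submodule.zero_mem _
  · intro u v hu hv h1 h2
    rw [grad_add hΩ (hX hu) (hX hv)]
    exact Submodule.add_mem _ h1 h2
  · intro c u hu h1
    rw [grad_smul hΩ (hX hu)]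
    exact Submodule.smul_mem _ _ h1

theorem podProj_mem (ψ : ℕ → L2Vec Ω) (s : ℕ) (u : L2Vec Ω) : podProj ψ s u ∈ podSpace ψ s :=
  Submodule.starProjection_apply_mem _ _

theorem inner_podProj {s : ℕ} (u : L2Vec Ω) {χ : L2Vec Ω} (hχ : χ ∈ podSpace ψ s) :
    inner ℝ (podProj ψ s u) χ = inner ℝ u χ := by
  have := Submodule.starProjection_inner_eq_zero (K := podSpace ψ s) u χ hχ
  rw [inner_sub_left] at this
  rw [podProj]
  linarith

theorem fluct_eq (ψ : ℕ → L2Vec Ω) (R : ℕ) (G : L2Mat Ω) :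
    fluct ψ R G = (podGradSpace ψ R)ᗮ.starProjection G := by
  rw [fluct, Submodule.starProjection_orthogonal_val]

theorem fluct_add (ψ : ℕ → L2Vec Ω) (R : ℕ) (G H : L2Mat Ω) :
    fluct ψ R (G + H) = fluct ψ R G + fluct ψ R H := by
  simp only [fluct_eq, map_add]

theorem fluct_sub (ψ : ℕ → L2Vec Ω) (R : ℕ) (G H : L2Mat Ω) :
    fluct ψ R (G - H) = fluct ψ R G - fluct ψ R H := by
  simp only [fluct_eq, map_sub]

theorem norm_fluct_le (ψ : ℕ → L2Vec Ω) (R : ℕ) (G : L2Mat Ω) : ‖fluct ψ R G‖ ≤ ‖G‖ := by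
  rw [fluct_eq]
  exact Submodule.norm_starProjection_apply_le _ _

theorem fluct_eq_zero {R : ℕ} {G : L2Mat Ω} (hG : G ∈ podGradSpace ψ R) : fluct ψ R G = 0 := by
  rw [fluct, Submodule.starProjection_eq_self_iff.2 hG, sub_self]

/-- The fluctuation annihilates the gradient of every field in `podSpace ψ R`, in particular that of
the `L²` projection of `u`. -/
theorem norm_fluct_grad_le (hΩ : IsOpen Ω) {R : ℕ} (hX : podSpace ψ R ≤ VelX Ω) {u : L2Vec Ω}
    (hu : u ∈ VelX Ω) : ‖fluct ψ R (grad u)‖ ≤ ‖grad (u - podProj ψ R u)‖ := by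
  have hm := podProj_mem ψ R u
  have h := norm_fluct_le ψ R (grad (u - podProj ψ R u))
  rw [grad_sub hΩ hu (hX hm), fluct_sub, fluct_eq_zero (grad_mem_podGradSpace hΩ hX hm),
    sub_zero] at h
  rwa [grad_sub hΩ hu (hX hm)]

end POD

/-! ### The dual norm -/

section Dual

variable {d : ℕ} {Ω : Set (EuclideanSpace ℝ (Fin d))}

theorem IsHNeg.abs_le {F : VelX Ω →ₗ[ℝ] ℝ} (hF : IsHNeg F) (v : VelX Ω) :
    |F v| ≤ normHNeg F * ‖grad (v : L2Vec Ω)‖ := by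
  obtain ⟨c, hc⟩ := hF
  rcases eq_or_lt_of_le (norm_nonneg (grad (v : L2Vec Ω))) with h0 | h0
  -- When `∇v = 0` the quotient carries no information, and the a priori bound `hc` forces `F v =
  -- 0`.
  · have := hc v
    rw [← h0, mul_zero] at this
    rwa [← h0, mul_zero]
  · rw [← div_le_iff₀ h0]
    refine le_ciSup (f := fun v : VelX Ω => |F v| / ‖grad (v : L2Vec Ω)‖) ⟨max c 0, ?_⟩ v
    rintro _ ⟨w, rfl⟩
    refine div_le_of_le_mul₀ (norm_nonneg _) (le_max_right _ _) ((hc w).trans ?_)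
    exact mul_le_mul_of_nonneg_right (le_max_left _ _) (norm_nonneg _)

end Dual

/-! ### Consistency of the backward difference -/

section Time

variable {E : Type*} [NormedAddCommGroup E] [NormedSpace ℝ E]

/-- Cauchy–Schwarz, read off from the nonnegative integral of `((b - a) f - I)²`, where `I` is the
integral of `f`. -/
theorem sq_intervalIntegral_le {a b : ℝ} (hab : a ≤ b) {f : ℝ → ℝ}
    (hf : IntervalIntegrable f volume a b)
    (hf2 : IntervalIntegrable (fun t => f t ^ 2) volume a b) :
    (∫ t in a..b, f t) ^ 2 ≤ (b - a) * ∫ t in a..b, f t ^ 2 := by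
  rcases eq_or_lt_of_le hab with rfl | hlt
  · simp
  set I := ∫ t in a..b, f t with hI
  set J := ∫ t in a..b, f t ^ 2 with hJ
  have hba : 0 < b - a := sub_pos.2 hlt
  have h1 : 0 ≤ ∫ t in a..b, ((b - a) * f t - I) ^ 2 :=
    intervalIntegral.integral_nonneg hab fun t _ => sq_nonneg _
  have h2 : ∫ t in a..b, ((b - a) * f t - I) ^ 2 = (b - a) ^ 2 * J - 2 * (b - a) * I * I
      + (b - a) * I ^ 2 := by
    have h3 : (fun t => ((b - a) * f t - I) ^ 2)
        = fun t => ((b - a) ^ 2 * f t ^ 2 - 2 * (b - a) * I * f t) + I ^ 2 := by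
      funext t; ring
    rw [h3, intervalIntegral.integral_add ((hf2.const_mul _).sub (hf.const_mul _))
      intervalIntegrable_const, intervalIntegral.integral_sub (hf2.const_mul _) (hf.const_mul _)]
    simp [hI, hJ]
  rw [h2] at h1
  have h4 : 0 ≤ (b - a) * ((b - a) * J - I ^ 2) := by linarith [h1]
  have := nonneg_of_mul_nonneg_right h4 hba
  linarith

/-- The function `u t - t • ut b` has derivative `ut t - ut b`, bounded by the integral of `‖utt‖`.
The mean value inequality gives `(b - a)²`, and Cauchy–Schwarz the third power. -/
theorem norm_sub_sub_smul_sq_le {T : ℝ} {u ut utt : ℝ → E} {g : ℝ → ℝ}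
    (hu : ∀ t ∈ Icc 0 T, HasDerivWithinAt u (ut t) (Icc 0 T) t)
    (hmeas : AEStronglyMeasurable utt (volume.restrict (Icc 0 T)))
    (hg : ∀ t, ‖utt t‖ ≤ g t) (hgint : IntegrableOn (fun t => g t ^ 2) (Icc 0 T))
    (hut : ∀ t ∈ Icc 0 T, ut t = ut 0 + ∫ s in (0 : ℝ)..t, utt s) {a b : ℝ} (ha : 0 ≤ a)
    (hab : a ≤ b) (hb : b ≤ T) :
    ‖u b - u a - (b - a) • ut b‖ ^ 2 ≤ (b - a) ^ 3 * ∫ t in a..b, g t ^ 2 := by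
  have hsq : IntegrableOn (fun t => ‖utt t‖ ^ 2) (Icc 0 T) := by
    refine hgint.mono' (hmeas.norm.pow 2) (Filter.Eventually.of_forall fun t => ?_)
    rw [Real.norm_of_nonneg (sq_nonneg _)]
    exact pow_le_pow_left₀ (norm_nonneg _) (hg t) 2
  have hint : IntegrableOn utt (Icc 0 T) :=
    ((memLp_two_iff_integrable_sq_norm hmeas).2 hsq).integrable (by norm_num)
  have hii (f : ℝ → E) (hf : IntegrableOn f (Icc 0 T)) {x z : ℝ} (hx : 0 ≤ x) (hxz : x ≤ z)
      (hz : z ≤ T) : IntervalIntegrable f volume x z :=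
    (intervalIntegrable_iff_integrableOn_Icc_of_le hxz).2
      (hf.mono_set (Icc_subset_Icc hx hz))
  have hii' (f : ℝ → ℝ) (hf : IntegrableOn f (Icc 0 T)) : IntervalIntegrable f volume a b :=
    (intervalIntegrable_iff_integrableOn_Icc_of_le hab).2
      (hf.mono_set (Icc_subset_Icc ha hb))
  set B := ∫ t in a..b, ‖utt t‖ with hB
  have hder (t : ℝ) (ht : t ∈ Icc a b) : ‖ut t - ut b‖ ≤ B := by
    have h0t : 0 ≤ t := ha.trans ht.1
    have htT : t ≤ T := ht.2.trans hb
    have e : ut b - ut t = ∫ s in t..b, utt s := by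
      rw [hut b ⟨ha.trans hab, hb⟩, hut t ⟨h0t, htT⟩, add_sub_add_left_eq_sub,
        intervalIntegral.integral_interval_sub_left (hii utt hint le_rfl (ha.trans hab) hb)
          (hii utt hint le_rfl h0t htT)]
    rw [norm_sub_rev, e]
    refine (intervalIntegral.norm_integral_le_integral_norm ht.2).trans ?_
    exact intervalIntegral.integral_mono_interval ht.1 ht.2 le_rfl
      (Filter.Eventually.of_forall fun _ => norm_nonneg _) (hii' _ hint.norm)
  have hmv := (convex_Icc a b).norm_image_sub_le_of_norm_hasDerivWithin_le
    (f := fun t => u t - t • ut b) (f' := fun t => ut t - ut b) (C := B) (x := a) (y := b)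
    (fun t ht => by
      have h1 := (hu t ⟨ha.trans ht.1, ht.2.trans hb⟩).mono (Icc_subset_Icc ha hb)
      have h2 := (hasDerivWithinAt_id t (Icc a b)).smul_const (ut b)
      rw [one_smul] at h2
      exact h1.sub h2)
    hder (left_mem_Icc.2 hab) (right_mem_Icc.2 hab)
  have e2 : u b - b • ut b - (u a - a • ut b) = u b - u a - (b - a) • ut b := by
    rw [sub_smul]; abel
  rw [e2, Real.norm_of_nonneg (sub_nonneg.2 hab)] at hmv
  have hB2 : B ^ 2 ≤ (b - a) * ∫ t in a..b, g t ^ 2 := by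
    refine (sq_intervalIntegral_le hab (hii' _ hint.norm) (hii' _ hsq)).trans ?_
    refine mul_le_mul_of_nonneg_left ?_ (sub_nonneg.2 hab)
    exact intervalIntegral.integral_mono_on hab (hii' _ hsq) (hii' _ hgint)
      fun t _ => pow_le_pow_left₀ (norm_nonneg _) (hg t) 2
  calc _ ≤ (B * (b - a)) ^ 2 := pow_le_pow_left₀ (norm_nonneg _) hmv 2
    _ = (b - a) ^ 2 * B ^ 2 := by ring
    _ ≤ (b - a) ^ 2 * ((b - a) * ∫ t in a..b, g t ^ 2) := by gcongr
    _ = _ := by ring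

end Time

/-! ### Young inequalities and the discrete Gronwall lemma -/

section Scalar

/-- The share `ν / 12` is chosen because six terms of the error equation must together use half of
the viscous term. -/
theorem mul_le_viscous_add {ν : ℝ} (hν : 0 < ν) (a b : ℝ) :
    a * b ≤ ν / 12 * a ^ 2 + 3 * ν⁻¹ * b ^ 2 := by
  have h : 0 ≤ ν⁻¹ * (ν * a - 6 * b) ^ 2 := by positivity
  have e : ν⁻¹ * (ν * a - 6 * b) ^ 2 = 12 * (ν / 12 * a ^ 2 + 3 * ν⁻¹ * b ^ 2 - a * b) := by
    field_simp; ring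
  linarith

/-- Young with exponents 4 and 4/3, obtained from two squares through the intermediate term `6 ν⁻¹
s² z²`. It is applied with `z = √‖∇φ‖`. -/
theorem mul_pow_three_le {ν : ℝ} (hν : 0 < ν) (s z : ℝ) :
    s * z ^ 3 ≤ ν / 12 * z ^ 4 + 216 * ν⁻¹ ^ 3 * s ^ 4 := by
  have h : 0 ≤ ν⁻¹ * (ν * z ^ 2 - 12 * (s * z)) ^ 2 := by positivity
  have h' : 0 ≤ ν⁻¹ ^ 3 * (ν ^ 2 * z ^ 2 - 72 * s ^ 2) ^ 2 := by positivity
  have e : ν⁻¹ * (ν * z ^ 2 - 12 * (s * z)) ^ 2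
      = 24 * (ν / 24 * z ^ 4 + 6 * ν⁻¹ * s ^ 2 * z ^ 2 - s * z ^ 3) := by
    field_simp; ring
  have e' : ν⁻¹ ^ 3 * (ν ^ 2 * z ^ 2 - 72 * s ^ 2) ^ 2
      = 24 * (ν / 24 * z ^ 4 + 216 * ν⁻¹ ^ 3 * s ^ 4 - 6 * ν⁻¹ * s ^ 2 * z ^ 2) := by
    field_simp; ring
  linarith

/-- The convective growth term, bounded either by absorbing into the viscous term or by the
inverse inequality `Y ^ 2 ≤ S * X ^ 2`. -/
theorem convective_growth_le {ν c K S X Y : ℝ} (hν : 0 < ν) (hc : 0 ≤ c) (hK : 0 ≤ K) (hS : 0 ≤ S)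
    (hX : 0 ≤ X) (hY : 0 ≤ Y) (h : Y ^ 2 ≤ S * X ^ 2) :
    c * (K * (√X * √Y ^ 3)) ≤ ν / 12 * Y ^ 2
      + (c + 216 * c ^ 4) * min (ν⁻¹ ^ 3 * K ^ 4) (S ^ (3 / 4 : ℝ) * K) * X ^ 2 := by
  have hX4 : √X ^ 4 = X ^ 2 := by
    rw [show √X ^ 4 = (√X ^ 2) ^ 2 by ring, Real.sq_sqrt hX]
  have hY4 : √Y ^ 4 = Y ^ 2 := by
    rw [show √Y ^ 4 = (√Y ^ 2) ^ 2 by ring, Real.sq_sqrt hY]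
  -- Absorption needs the part `216 * c ^ 4` of the coefficient, the inverse inequality the part
  -- `c`; the sum serves both cases.
  rcases min_choice (ν⁻¹ ^ 3 * K ^ 4) (S ^ (3 / 4 : ℝ) * K) with hm | hm <;> rw [hm]
  · have h1 := mul_pow_three_le hν (c * K * √X) (√Y)
    rw [hY4, mul_pow _ (√X), hX4] at h1
    have h2 : 0 ≤ c * (ν⁻¹ ^ 3 * K ^ 4) * X ^ 2 := by positivity
    calc _ = c * K * √X * √Y ^ 3 := by ring
      _ ≤ _ := h1
      _ ≤ _ := by rw [mul_pow]; linarith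
  · have h3 : √Y ^ 3 ≤ S ^ (3 / 4 : ℝ) * √X ^ 3 := by
      have e (a : ℝ) (ha : 0 ≤ a) : √a ^ 3 = (a ^ 2) ^ (3 / 4 : ℝ) := by
        rw [Real.sqrt_eq_rpow, ← Real.rpow_natCast, ← Real.rpow_natCast, ← Real.rpow_mul ha,
          ← Real.rpow_mul ha]
        norm_num
      rw [e Y hY, e X hX, ← Real.mul_rpow hS (sq_nonneg _)]
      exact Real.rpow_le_rpow (sq_nonneg _) h (by norm_num)
    have h4 : c * (K * (√X * √Y ^ 3)) ≤ c * (K * (√X * (S ^ (3 / 4 : ℝ) * √X ^ 3))) := by gcongr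
    have h5 : c * (K * (√X * (S ^ (3 / 4 : ℝ) * √X ^ 3)))
        = c * (S ^ (3 / 4 : ℝ) * K) * X ^ 2 := by rw [← hX4]; ring
    have h6 : 0 ≤ 216 * c ^ 4 * (S ^ (3 / 4 : ℝ) * K) * X ^ 2 := by positivity
    have h7 : 0 ≤ ν / 12 * Y ^ 2 := by positivity
    linarith

/-- An implicit discrete Gronwall inequality for a two-step scheme. -/
theorem discrete_gronwall {a x g g' D D' : ℕ → ℝ} {k : ℝ} {M : ℕ} (hk : 0 ≤ k) (hk' : k ≤ 1 / 2)
    (hx : ∀ n, 0 ≤ x n) (hg : ∀ n, 0 ≤ g n) (hg' : ∀ n, 0 ≤ g' n) (hD : ∀ n, 0 ≤ D n) (hD' : ∀ n, 0 ≤ D' n)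
    (h1 : ∀ n < M, x n + D n ≤ a n + k * x n + g n)
    (h2 : ∀ n < M, a (n + 1) + D' n ≤ x n + g' n) :
    a M + ∑ n ∈ Finset.range M, (D n + D' n)
      ≤ Real.exp (2 * k * M) * (a 0 + ∑ n ∈ Finset.range M, (g n + g' n)) := by
  have main : ∀ n ≤ M, a n + ∑ i ∈ Finset.range n, (D i + D' i)
      ≤ Real.exp (2 * k * n) * (a 0 + ∑ i ∈ Finset.range n, (g i + g' i)) := by
    intro n
    induction n with
    | zero => simp
    | succ n ih =>
      intro hn
      have ih := ih (by omega)
      have s1 := h1 n (by omega)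
      have s2 := h2 n (by omega)
      have he : 1 + 2 * k ≤ Real.exp (2 * k) := by linarith [Real.add_one_le_exp (2 * k)]
      have hsum : 0 ≤ ∑ i ∈ Finset.range n, (D i + D' i) :=
        Finset.sum_nonneg fun i _ => add_nonneg (hD i) (hD' i)
      have he1 : 1 ≤ Real.exp (2 * k * n) := Real.one_le_exp (by positivity)
      have hexp : Real.exp (2 * k * ((n + 1 : ℕ) : ℝ))
          = Real.exp (2 * k) * Real.exp (2 * k * n) := by
        rw [← Real.exp_add]; push_cast; ring_nf
      rw [hexp, Finset.sum_range_succ, Finset.sum_range_succ]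
      set E := Real.exp (2 * k)
      set F := Real.exp (2 * k * n)
      set G := ∑ i ∈ Finset.range n, (g i + g' i)
      set Z := ∑ i ∈ Finset.range n, (D i + D' i)
      have hE1 : 1 ≤ E := by linarith
      -- `(1 + 2k)(1 - k) ≥ 1` holds exactly because `0 ≤ k ≤ 1/2`; this is where the time step
      -- restriction is used.
      have hEk : 1 ≤ E * (1 - k) := by
        nlinarith [mul_le_mul_of_nonneg_right he (by linarith : (0 : ℝ) ≤ 1 - k)]
      have s3 : x n + D n ≤ E * (a n + g n) := by
        have p1 : (1 - k) * (x n + D n) ≤ a n + g n := by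
          linarith [mul_nonneg hk (hD n)]
        have p2 : 0 ≤ x n + D n := add_nonneg (hx n) (hD n)
        calc x n + D n = 1 * (x n + D n) := (one_mul _).symm
          _ ≤ E * (1 - k) * (x n + D n) := by gcongr
          _ = E * ((1 - k) * (x n + D n)) := by ring
          _ ≤ _ := by gcongr
      have hgg : 0 ≤ g n + g' n := add_nonneg (hg n) (hg' n)
      calc a (n + 1) + (Z + (D n + D' n)) ≤ E * (a n + g n) + g' n + Z := by linarith
        _ ≤ E * (a n + g n) + E * g' n + E * Z := by
            gcongr
            · exact le_mul_of_one_le_left (hg' n) hE1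
            · exact le_mul_of_one_le_left hsum hE1
        _ = E * ((a n + Z) + (g n + g' n)) := by ring
        _ ≤ E * (F * (a 0 + G) + F * (g n + g' n)) := by
            gcongr
            exact le_mul_of_one_le_left hgg he1
        _ = E * F * (a 0 + (G + (g n + g' n))) := by ring
  exact main M le_rfl

end Scalar

/-! ### Error equations of the two steps, stability and pressure -/

section Steps

open scoped NNReal

variable {d : ℕ} {Ω : Set (EuclideanSpace ℝ (Fin d))}

theorem half_norm_sq_sub_le_inner {E : Type*} [NormedAddCommGroup E] [InnerProductSpace ℝ E]
    (a b : E) : 1 / 2 * (‖a‖ ^ 2 - ‖b‖ ^ 2) ≤ inner ℝ (a - b) a := by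
  have := norm_sub_sq_real a b
  rw [inner_sub_left, real_inner_self_eq_norm_sq, real_inner_comm]
  nlinarith [sq_nonneg ‖a - b‖]

theorem inner_sub_half_add {E : Type*} [NormedAddCommGroup E] [InnerProductSpace ℝ E] (a b : E) :
    inner ℝ (a - b) ((1 / 2 : ℝ) • (a + b)) = 1 / 2 * (‖a‖ ^ 2 - ‖b‖ ^ 2) := by
  rw [real_inner_smul_right, inner_sub_left, inner_add_right, inner_add_right,
    real_inner_self_eq_norm_sq, real_inner_self_eq_norm_sq, real_inner_comm a b]
  ring

/-- The error equation of the Galerkin step, tested with the discrete error. -/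
theorem galerkin_error_step (hΩ : IsOpen Ω) {C : ℝ≥0} (hC : SobolevSix Ω C) {c : ℝ} (hc : 0 ≤ c)
    (hP : ∀ u : L2Vec Ω, u ∈ VelX Ω → ‖u‖ ≤ c * ‖grad u‖)
    (hb : ∀ u v w : L2Vec Ω, u ∈ VelX Ω → v ∈ VelX Ω → w ∈ VelX Ω →
        |triB u v w| ≤ c * (‖grad u‖ * ‖grad v‖ * ‖grad w‖))
    (hb' : ∀ u v : L2Vec Ω, u ∈ VelX Ω → v ∈ VelX Ω →
        |triB v u v| ≤ c * (‖grad u‖ * (√‖v‖ * √‖grad v‖ ^ 3)))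
    {ν Δt K S P I Fφ : ℝ} (hν : 0 < ν) (hΔt : 0 < Δt) (hS0 : 0 ≤ S)
    {u' u₀ ut w ur v' v₀ : L2Vec Ω} {p : L2 Ω} (hu' : u' ∈ VelX Ω) (hw : w ∈ VelX Ω)
    (hv' : v' ∈ VelX Ω)
    (hmom : inner ℝ ut (w - v') + ν * inner ℝ (grad u') (grad (w - v')) + triB u' u' (w - v')
      - inner ℝ p (divg (w - v')) = Fφ)
    (hsch : inner ℝ ((1 / Δt) • (w - ur)) (w - v') + triB w w (w - v')
      + ν * inner ℝ (grad w) (grad (w - v')) = Fφ)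
    (hproj : inner ℝ (v' - v₀) (w - v') = inner ℝ (u' - u₀) (w - v'))
    (hp : |inner ℝ p (divg (w - v'))| ≤ P * ‖grad (w - v')‖)
    (ht : ‖u' - u₀ - Δt • ut‖ ^ 2 ≤ Δt ^ 3 * I)
    (hK : ‖grad u'‖ ≤ K) (hS : ‖grad (w - v')‖ ^ 2 ≤ S * ‖w - v'‖ ^ 2) :
    ‖w - v'‖ ^ 2 + ν * Δt * ‖grad (w - v')‖ ^ 2 ≤ ‖ur - v₀‖ ^ 2
      + 2 * Δt * ((c + 216 * c ^ 4) * min (ν⁻¹ ^ 3 * K ^ 4) (S ^ (3 / 4 : ℝ) * K)) * ‖w - v'‖ ^ 2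
      + 2 * Δt * (3 * ν * ‖grad (u' - v')‖ ^ 2 + 3 * ν⁻¹ * P ^ 2 + 3 * ν⁻¹ * c ^ 2 * (Δt * I)
          + 3 * ν⁻¹ * c ^ 2 * (‖grad (u' - v')‖ ^ 2 * ‖grad u'‖ ^ 2)
          + 3 * ν⁻¹ * c ^ 2 * (‖grad (u' - v')‖ ^ 2 * ‖grad w‖ ^ 2)) := by
  have hφ : w - v' ∈ VelX Ω := Submodule.sub_mem _ hw hv'
  have hη : u' - v' ∈ VelX Ω := Submodule.sub_mem _ hu' hv'
  have hsplit := hC.triB_sub_triB hΩ hu' hw hη hφ (by abel)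
  have b1 := hb _ _ _ hη hu' hφ
  have b2 := hb _ _ _ hw hη hφ
  have b3 := hb' _ _ hu' hφ
  have hg : grad w = grad (w - v') + grad u' - grad (u' - v') := by
    rw [grad_sub hΩ hw hv', grad_sub hΩ hu' hv']; abel
  -- The increment `v' - v₀` is exchanged for `u' - u₀` through `hproj`, so no projection error of
  -- the time difference appears.
  have hwu : w - ur = ((w - v') - (ur - v₀)) + (v' - v₀) := by abel
  have hin := half_norm_sq_sub_le_inner (w - v') (ur - v₀)
  have hPφ := hP _ hφ
  set φ := w - v' with hφdef
  set η := u' - v' with hηdef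
  set e := ur - v₀
  -- consistency in time
  set θ := ‖u' - u₀ - Δt • ut‖ with hθ
  have hcons : inner ℝ (u' - u₀) φ - Δt * inner ℝ ut φ ≥ -(θ * ‖φ‖) := by
    have h1 : inner ℝ (u' - u₀ - Δt • ut) φ = inner ℝ (u' - u₀) φ - Δt * inner ℝ ut φ := by
      rw [inner_sub_left, real_inner_smul_left]
    have h2 := abs_real_inner_le_norm (u' - u₀ - Δt • ut) φ
    rw [h1] at h2
    exact (abs_le.1 h2).1
  have hηφ := real_inner_le_norm (grad η) (grad φ)
  -- the error equation
  have hsch' : Δt * Fφ = inner ℝ (φ - e) φ + inner ℝ (u' - u₀) φ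
      + Δt * (triB w w φ + ν * inner ℝ (grad w) (grad φ)) := by
    rw [← hsch, hwu, real_inner_smul_left, inner_add_left, hproj]
    field_simp
    ring
  have hgw : inner ℝ (grad w) (grad φ) = ‖grad φ‖ ^ 2 + inner ℝ (grad u') (grad φ)
      - inner ℝ (grad η) (grad φ) := by
    rw [hg, inner_sub_left, inner_add_left, real_inner_self_eq_norm_sq]
  rw [← hmom, hgw] at hsch'
  have hX := norm_nonneg φ
  have hY := norm_nonneg (grad φ)
  have hgr := convective_growth_le hν hc ((norm_nonneg _).trans hK) hS0 hX hY hS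
  have b3' : |triB φ u' φ| ≤ c * (K * (√‖φ‖ * √‖grad φ‖ ^ 3)) := by
    refine b3.trans ?_
    gcongr
  set Y := ‖grad φ‖
  set X := ‖φ‖
  have y1 := mul_le_viscous_add hν Y (ν * ‖grad η‖)
  have y2 := mul_le_viscous_add hν Y P
  have y3 := mul_le_viscous_add hν Y (c * (θ / Δt))
  have y4 := mul_le_viscous_add hν Y (c * (‖grad η‖ * ‖grad u'‖))
  have y5 := mul_le_viscous_add hν Y (c * (‖grad η‖ * ‖grad w‖))
  have e1 : 3 * ν⁻¹ * (ν * ‖grad η‖) ^ 2 = 3 * ν * ‖grad η‖ ^ 2 := by field_simp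
  have e3 : 3 * ν⁻¹ * (c * (θ / Δt)) ^ 2 ≤ 3 * ν⁻¹ * c ^ 2 * (Δt * I) := by
    have : (θ / Δt) ^ 2 ≤ Δt * I := by
      rw [div_pow, div_le_iff₀ (by positivity)]
      linarith
    rw [mul_pow, ← mul_assoc]
    gcongr
  -- Poincaré moves the consistency error onto `‖∇φ‖`, so that viscosity absorbs it and it does not
  -- add to the Gronwall rate.
  have e3' : θ * X ≤ Δt * (Y * (c * (θ / Δt))) := by
    calc θ * X ≤ θ * (c * Y) := by gcongr
      _ = _ := by field_simp
  have hη' : ν * inner ℝ (grad η) (grad φ) ≤ Y * (ν * ‖grad η‖) := by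
    have := mul_le_mul_of_nonneg_left hηφ hν.le
    linarith
  have b1' := (abs_le.1 b1).2
  have b2' := (abs_le.1 b2).2
  have b3'' := (abs_le.1 b3').1
  have hp' := (abs_le.1 hp).1
  set κ := (c + 216 * c ^ 4) * min (ν⁻¹ ^ 3 * K ^ 4) (S ^ (3 / 4 : ℝ) * K)
  -- collect the terms multiplied by the time step
  have hcol : ν * inner ℝ (grad η) (grad φ) - inner ℝ p (divg φ)
      + (triB u' u' φ - triB w w φ) + Y * (c * (θ / Δt)) - ν * Y ^ 2
      ≤ -(1 / 2) * ν * Y ^ 2 + κ * X ^ 2 + (3 * ν * ‖grad η‖ ^ 2 + 3 * ν⁻¹ * P ^ 2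
          + 3 * ν⁻¹ * c ^ 2 * (Δt * I)
          + 3 * ν⁻¹ * c ^ 2 * (‖grad η‖ ^ 2 * ‖grad u'‖ ^ 2)
          + 3 * ν⁻¹ * c ^ 2 * (‖grad η‖ ^ 2 * ‖grad w‖ ^ 2)) := by
    rw [hsplit]
    rw [e1] at y1
    have e4 : 3 * ν⁻¹ * (c * (‖grad η‖ * ‖grad u'‖)) ^ 2
        = 3 * ν⁻¹ * c ^ 2 * (‖grad η‖ ^ 2 * ‖grad u'‖ ^ 2) := by ring
    have e5 : 3 * ν⁻¹ * (c * (‖grad η‖ * ‖grad w‖)) ^ 2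
        = 3 * ν⁻¹ * c ^ 2 * (‖grad η‖ ^ 2 * ‖grad w‖ ^ 2) := by ring
    rw [e4] at y4
    rw [e5] at y5
    linarith
  have hcol' := mul_le_mul_of_nonneg_left hcol hΔt.le
  linarith

/-- The error equation of the post-processing step, tested with the mean of the discrete errors. -/
theorem postprocessing_error_step (hΩ : IsOpen Ω) {ψ : ℕ → L2Vec Ω} {R : ℕ} {νT Δt : ℝ}
    (hνT : 0 < νT) (hΔt : 0 < Δt) {w ur v : L2Vec Ω} (hw : w ∈ VelX Ω) (hur : ur ∈ VelX Ω)
    (hv : v ∈ VelX Ω)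
    (h : inner ℝ ((1 / Δt) • (w - ur)) ((1 / 2 : ℝ) • ((w - v) + (ur - v)))
      = νT * inner ℝ (fluct ψ R (grad ((1 / 2 : ℝ) • (w + ur))))
          (fluct ψ R (grad ((1 / 2 : ℝ) • ((w - v) + (ur - v)))))) :
    ‖ur - v‖ ^ 2 + Δt * νT * ‖fluct ψ R (grad ((1 / 2 : ℝ) • ((w - v) + (ur - v))))‖ ^ 2
      ≤ ‖w - v‖ ^ 2 + Δt * νT * ‖fluct ψ R (grad v)‖ ^ 2 := by
  have hθ : (1 / 2 : ℝ) • ((w - v) + (ur - v)) ∈ VelX Ω := Submodule.smul_mem _ _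
    (Submodule.add_mem _ (Submodule.sub_mem _ hw hv) (Submodule.sub_mem _ hur hv))
  -- The scheme dissipates the mean of the solutions, not of the errors; the discrepancy `v` is the
  -- only source of this step.
  have e1 : (1 / 2 : ℝ) • (w + ur) = (1 / 2 : ℝ) • ((w - v) + (ur - v)) + v := by module
  have e2 : w - ur = (w - v) - (ur - v) := by abel
  rw [e1, grad_add hΩ hθ hv, fluct_add, inner_add_left, real_inner_self_eq_norm_sq, e2,
    real_inner_smul_left, inner_sub_half_add] at h
  set a := fluct ψ R (grad ((1 / 2 : ℝ) • ((w - v) + (ur - v))))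
  set b := fluct ψ R (grad v)
  have h1 := (abs_le.1 (abs_real_inner_le_norm b a)).1
  have h2 : ‖w - v‖ ^ 2 - ‖ur - v‖ ^ 2 = 2 * (Δt * νT) * (‖a‖ ^ 2 + inner ℝ b a) := by
    field_simp at h
    linarith
  have h3 : 0 < Δt * νT := mul_pos hΔt hνT
  nlinarith [mul_nonneg h3.le (sq_nonneg (‖b‖ - ‖a‖)),
    mul_le_mul_of_nonneg_left h1 h3.le]

/-- Testing the first step with `w` and the second with the mean of `w` and `ur` shows that
post-processing cannot increase the norm. The result supplies the summed bound on `‖∇w‖²` needed for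
`triB w η φ`. -/
theorem IsVmsPodScheme.stability {ν νT Δt : ℝ} {M r R : ℕ} {ψ : ℕ → L2Vec Ω}
    {f : ℝ → VelX Ω →ₗ[ℝ] ℝ} {u0 : L2Vec Ω} {ur w : ℕ → L2Vec Ω}
    (h : IsVmsPodScheme ν νT Δt M r R ψ f u0 ur w) (hν : 0 < ν) (hνT : 0 < νT) (hΔt : 0 < Δt)
    (hX : podSpace ψ r ≤ VelX Ω) (hf : ∀ n < M, IsHNeg (f ((n + 1 : ℕ) * Δt))) :
    ν * ∑ n ∈ Finset.range M, Δt * ‖grad (w (n + 1))‖ ^ 2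
      ≤ ‖ur 0‖ ^ 2 + ν⁻¹ * (Δt * ∑ n ∈ Finset.range M, normHNeg (f ((n + 1 : ℕ) * Δt)) ^ 2) := by
  have step (n : ℕ) (hn : n < M) : ‖ur (n + 1)‖ ^ 2 + ν * (Δt * ‖grad (w (n + 1))‖ ^ 2)
      ≤ ‖ur n‖ ^ 2 + ν⁻¹ * (Δt * normHNeg (f ((n + 1 : ℕ) * Δt)) ^ 2) := by
    have hw := h.mem_w (n + 1) hn
    have hur := h.mem_ur (n + 1) hn
    have s1 := h.step1 n hn ⟨w (n + 1), hX hw⟩ hw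
    have s2 := h.step2 n hn _ (Submodule.smul_mem _ (1 / 2 : ℝ) (Submodule.add_mem _ hw hur))
    have s3 := (abs_le.1 ((hf n hn).abs_le ⟨w (n + 1), hX hw⟩)).2
    simp only at s1 s3
    rw [triB_self, add_zero, real_inner_self_eq_norm_sq, real_inner_smul_left] at s1
    rw [real_inner_self_eq_norm_sq, real_inner_smul_left, inner_sub_half_add] at s2
    have i1 := half_norm_sq_sub_le_inner (w (n + 1)) (ur n)
    have s2' : 0 ≤ 1 / Δt * (1 / 2 * (‖w (n + 1)‖ ^ 2 - ‖ur (n + 1)‖ ^ 2)) := by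
      rw [s2]; positivity
    have s2'' : ‖ur (n + 1)‖ ^ 2 ≤ ‖w (n + 1)‖ ^ 2 := by
      have := nonneg_of_mul_nonneg_right s2' (by positivity)
      linarith
    have s1' : inner ℝ (w (n + 1) - ur n) (w (n + 1)) + Δt * (ν * ‖grad (w (n + 1))‖ ^ 2)
        = Δt * f ((n + 1 : ℕ) * Δt) ⟨w (n + 1), hX hw⟩ := by
      rw [← s1]; field_simp
    set F := normHNeg (f ((n + 1 : ℕ) * Δt))
    set Y := ‖grad (w (n + 1))‖
    have yo : 2 * (F * Y) ≤ ν * Y ^ 2 + ν⁻¹ * F ^ 2 := by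
      have h0 : 0 ≤ ν⁻¹ * (ν * Y - F) ^ 2 := by positivity
      have e : ν⁻¹ * (ν * Y - F) ^ 2 = ν * Y ^ 2 + ν⁻¹ * F ^ 2 - 2 * (F * Y) := by
        field_simp; ring
      linarith
    have yo' := mul_le_mul_of_nonneg_left yo hΔt.le
    have s3' := mul_le_mul_of_nonneg_left s3 hΔt.le
    linarith
  have main : ∀ n ≤ M, ‖ur n‖ ^ 2 + ν * ∑ i ∈ Finset.range n, Δt * ‖grad (w (i + 1))‖ ^ 2
      ≤ ‖ur 0‖ ^ 2 + ν⁻¹ * (Δt * ∑ i ∈ Finset.range n, normHNeg (f ((i + 1 : ℕ) * Δt)) ^ 2) := by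
    intro n
    induction n with
    | zero => simp
    | succ n ih =>
      intro hn
      have := ih (by omega)
      have := step n (by omega)
      rw [Finset.sum_range_succ, Finset.sum_range_succ]
      linarith
  have := main M le_rfl
  linarith [sq_nonneg ‖ur M‖]

/-- Any `q ∈ Qh` may be subtracted from `p`. Passing to the infimum needs no best approximation, so
`Qh` need not be closed. -/
theorem abs_inner_divg_le {Qh : Submodule ℝ (L2 Ω)} {p : L2 Ω} {φ : L2Vec Ω} {ε : ℝ}
    (hp : Metric.infDist p (Qh : Set (L2 Ω)) ≤ ε) (hφ : ∀ q ∈ Qh, inner ℝ (divg φ) q = 0) :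
    |inner ℝ p (divg φ)| ≤ d * ε * ‖grad φ‖ := by
  have h1 : |inner ℝ p (divg φ)| ≤ ε * ‖divg φ‖ := by
    rcases eq_or_lt_of_le (norm_nonneg (divg φ)) with h0 | h0
    · have := abs_real_inner_le_norm p (divg φ)
      rw [← h0, mul_zero] at this ⊢
      exact this
    · rw [← div_le_iff₀ h0]
      refine le_trans ((Metric.le_infDist ⟨0, Qh.zero_mem⟩).2 fun q hq => ?_) hp
      rw [div_le_iff₀ h0, dist_eq_norm]
      have h2 : inner ℝ p (divg φ) = inner ℝ (p - q) (divg φ) := by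
        rw [inner_sub_left, real_inner_comm _ q, hφ q hq, sub_zero]
      rw [h2]
      exact abs_real_inner_le_norm _ _
  have hε : 0 ≤ ε := Metric.infDist_nonneg.trans hp
  calc _ ≤ ε * ‖divg φ‖ := h1
    _ ≤ ε * (d * ‖grad φ‖) := by gcongr; exact norm_divg_le φ
    _ = _ := by ring

theorem inner_divg_eq_zero_of_mem_span (hΩ : IsOpen Ω) {ι : Type*} {y : ι → L2Vec Ω} {q : L2 Ω}
    (hX : ∀ k, y k ∈ VelX Ω) (hy : ∀ k, inner ℝ (divg (y k)) q = 0) {φ : L2Vec Ω}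
    (hφ : φ ∈ Submodule.span ℝ (Set.range y)) : inner ℝ (divg φ) q = 0 := by
  -- Membership in `VelX Ω` is carried through the induction because `divg` is known to be linear
  -- only there.
  have : ∃ h : φ ∈ VelX Ω, inner ℝ (divX hΩ ⟨φ, h⟩) q = 0 := by
    refine Submodule.span_induction
      (p := fun φ _ => ∃ h : φ ∈ VelX Ω, inner ℝ (divX hΩ ⟨φ, h⟩) q = 0) ?_ ?_ ?_ ?_ hφ
    · rintro _ ⟨k, rfl⟩
      exact ⟨hX k, hy k⟩
    · refine ⟨Submodule.zero_mem _, ?_⟩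
      have : (divX hΩ) ⟨0, Submodule.zero_mem _⟩ = 0 := (divX hΩ).map_zero
      rw [this, inner_zero_left]
    · rintro u v - - ⟨h1, h2⟩ ⟨h3, h4⟩
      refine ⟨Submodule.add_mem _ h1 h3, ?_⟩
      have := (divX hΩ).map_add ⟨u, h1⟩ ⟨v, h3⟩
      rw [AddMemClass.mk_add_mk] at this
      rw [this, inner_add_left, h2, h4, add_zero]
    · rintro a u - ⟨h1, h2⟩
      refine ⟨Submodule.smul_mem _ _ h1, ?_⟩
      have := (divX hΩ).map_smul a ⟨u, h1⟩
      rw [SetLike.mk_smul_mk] at this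
      rw [this, real_inner_smul_left, h2, mul_zero]
  exact this.2

end Steps

/-! ### Summation of the sources and collection of constants -/

section Assembly

variable {d : ℕ} {Ω : Set (EuclideanSpace ℝ (Fin d))}

theorem sum_succ_le_discL2_sq {Δt : ℝ} (hΔt : 0 ≤ Δt) (M : ℕ) (a : ℕ → ℝ) :
    Δt * ∑ n ∈ Finset.range M, a (n + 1) ^ 2 ≤ discL2 Δt M a ^ 2 := by
  rw [discL2, Real.sq_sqrt (mul_nonneg hΔt (Finset.sum_nonneg fun _ _ => sq_nonneg _)),
    Finset.sum_range_succ']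
  gcongr
  linarith [sq_nonneg (a 0)]

theorem le_discMax {M n : ℕ} (hn : n ≤ M) (a : ℕ → ℝ) : a n ≤ discMax M a :=
  Finset.le_sup' a (Finset.mem_range.2 (by omega))

theorem stiffNorm_nonneg (ψ : ℕ → L2Vec Ω) (s : ℕ) : 0 ≤ stiffNorm ψ s := norm_nonneg _

theorem IsPODBasis.tail_nonneg {M N : ℕ} {y : Fin M → L2Vec Ω} {ψ : ℕ → L2Vec Ω} {lam : ℕ → ℝ}
    (h : IsPODBasis y N ψ lam) (s : ℕ) : 0 ≤ tail N lam s :=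
  Finset.sum_nonneg fun j hj => (h.lam_pos j (Finset.mem_Ico.1 hj).2).le

theorem IsPODBasis.tailH1_nonneg {M N : ℕ} {y : Fin M → L2Vec Ω} {ψ : ℕ → L2Vec Ω} {lam : ℕ → ℝ}
    (h : IsPODBasis y N ψ lam) (s : ℕ) : 0 ≤ tailH1 N ψ lam s :=
  Finset.sum_nonneg fun j hj =>
    mul_nonneg (sq_nonneg _) (h.lam_pos j (Finset.mem_Ico.1 hj).2).le

theorem norm_sub_sq_le_two_mul {E : Type*} [SeminormedAddCommGroup E] (a b : E) :
    ‖a - b‖ ^ 2 ≤ 2 * ‖a‖ ^ 2 + 2 * ‖b‖ ^ 2 := by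
  have h : ‖a - b‖ ^ 2 ≤ (‖a‖ + ‖b‖) ^ 2 := pow_le_pow_left₀ (norm_nonneg _) (norm_sub_le a b) 2
  nlinarith [sq_nonneg (‖a‖ - ‖b‖)]

/-- Writing `P_r u = u - (u - P_r u)` explains why the eddy viscosity term contains the errors of
both projections. -/
theorem norm_fluct_grad_proj_sq_le (hΩ : IsOpen Ω) {ψ : ℕ → L2Vec Ω} {r R : ℕ}
    (hr : podSpace ψ r ≤ VelX Ω) (hR : podSpace ψ R ≤ VelX Ω) {u : L2Vec Ω} (hu : u ∈ VelX Ω) :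
    ‖fluct ψ R (grad (podProj ψ r u))‖ ^ 2
      ≤ 2 * ‖grad (u - podProj ψ R u)‖ ^ 2 + 2 * ‖grad (u - podProj ψ r u)‖ ^ 2 := by
  have hv := hr (podProj_mem ψ r u)
  have e : grad (podProj ψ r u) = grad u - grad (u - podProj ψ r u) := by
    rw [grad_sub hΩ hu hv]; abel
  rw [e, fluct_sub]
  refine (norm_sub_sq_le_two_mul _ _).trans ?_
  have h1 := norm_fluct_grad_le hΩ hR hu
  have h2 := norm_fluct_le ψ R (grad (u - podProj ψ r u))
  gcongr

theorem sum_intervalIntegral_steps {Δt T : ℝ} {M : ℕ} (hΔt : 0 < Δt) (hT : M * Δt = T)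
    {g : ℝ → ℝ} (hg : IntegrableOn g (Icc 0 T)) :
    ∑ n ∈ Finset.range M, ∫ t in (n * Δt)..((n + 1 : ℕ) * Δt), g t = ∫ t in (0 : ℝ)..T, g t := by
  rw [intervalIntegral.sum_integral_adjacent_intervals (a := fun n : ℕ => (n : ℝ) * Δt)]
  · simp [hT]
  · intro n hn
    have h1 : (n : ℝ) * Δt ≤ (n + 1 : ℕ) * Δt := by gcongr; omega
    refine (intervalIntegrable_iff_integrableOn_Icc_of_le h1).2
      (hg.mono_set (Icc_subset_Icc (by positivity) ?_))
    rw [← hT]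
    gcongr
    omega

/-- The sequence `W` stands for `‖∇w‖²`. Its bound `hW` carries a factor `ν`, and dividing by it
turns `ν⁻¹` into the `ν⁻¹ ^ 2` of the estimate. -/
theorem sum_error_sources_le {M : ℕ} {Δt T ν νT a A Z c q D J U Wb : ℝ} {P I V W : ℕ → ℝ}
    (hMT : M * Δt = T) (hν : 0 < ν) (haA : 0 ≤ a * A) (hq : 0 ≤ q)
    (hP : Δt * ∑ n ∈ Finset.range M, P n ≤ D) (hI : ∑ n ∈ Finset.range M, I n = J)
    (hV : Δt * ∑ n ∈ Finset.range M, V n ≤ U)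
    (hW : ν * ∑ n ∈ Finset.range M, Δt * W n ≤ Wb) :
    ∑ n ∈ Finset.range M, (2 * Δt * (3 * ν * (a * A) + 3 * ν⁻¹ * (q * P n)
        + 3 * ν⁻¹ * c ^ 2 * (Δt * I n) + 3 * ν⁻¹ * c ^ 2 * (a * A * V n)
        + 3 * ν⁻¹ * c ^ 2 * (a * A * W n)) + Δt * νT * (4 * (a * Z)))
      ≤ 6 * T * a * (ν * A) + 6 * ν⁻¹ * q * D + 6 * c ^ 2 * (ν⁻¹ * Δt ^ 2 * J)
        + 6 * c ^ 2 * a * (ν⁻¹ * U * A) + 6 * c ^ 2 * a * (ν⁻¹ ^ 2 * Wb * A)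
        + 4 * a * T * (νT * Z) := by
  have hW' : Δt * ∑ n ∈ Finset.range M, W n ≤ ν⁻¹ * Wb := by
    rw [← Finset.mul_sum] at hW
    rwa [inv_mul_eq_div, le_div_iff₀' hν]
  have e : ∑ n ∈ Finset.range M, (2 * Δt * (3 * ν * (a * A) + 3 * ν⁻¹ * (q * P n)
        + 3 * ν⁻¹ * c ^ 2 * (Δt * I n) + 3 * ν⁻¹ * c ^ 2 * (a * A * V n)
        + 3 * ν⁻¹ * c ^ 2 * (a * A * W n)) + Δt * νT * (4 * (a * Z)))
      = 6 * (M * Δt) * a * (ν * A) + 6 * ν⁻¹ * q * (Δt * ∑ n ∈ Finset.range M, P n)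
        + 6 * c ^ 2 * (ν⁻¹ * Δt ^ 2 * ∑ n ∈ Finset.range M, I n)
        + 6 * ν⁻¹ * c ^ 2 * (a * A) * (Δt * ∑ n ∈ Finset.range M, V n)
        + 6 * ν⁻¹ * c ^ 2 * (a * A) * (Δt * ∑ n ∈ Finset.range M, W n)
        + 4 * a * (M * Δt) * (νT * Z) := by
    simp only [Finset.sum_add_distrib, ← Finset.mul_sum, Finset.sum_const, Finset.card_range,
      nsmul_eq_mul]
    ring
  rw [e, hMT, hI]
  have hν' : 0 ≤ ν⁻¹ := (inv_pos.2 hν).le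
  have p1 := mul_le_mul_of_nonneg_left hP (by positivity : 0 ≤ 6 * ν⁻¹ * q)
  have p2 := mul_le_mul_of_nonneg_left hV (by positivity : 0 ≤ 6 * ν⁻¹ * c ^ 2 * (a * A))
  have p3 := mul_le_mul_of_nonneg_left hW' (by positivity : 0 ≤ 6 * ν⁻¹ * c ^ 2 * (a * A))
  linarith

theorem error_sources_le {T a b c ν νT A Z L U W H D J : ℝ} (hT : 0 ≤ T) (ha : 0 ≤ a)
    (hν : 0 < ν) (hνT : 0 ≤ νT) (hA : 0 ≤ A) (hZ : 0 ≤ Z) (hL : 0 ≤ L) (hU : 0 ≤ U) (hW : 0 ≤ W)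
    (hH : 0 ≤ H) (hD : 0 ≤ D) (hJ : 0 ≤ J) :
    6 * T * a * (ν * A) + 6 * ν⁻¹ * (b ^ 2 * H) * D + 6 * c ^ 2 * J
        + 6 * c ^ 2 * a * (ν⁻¹ * U * A) + 6 * c ^ 2 * a * (ν⁻¹ ^ 2 * W * A)
        + 4 * a * T * (νT * Z)
      ≤ (6 * T * a + 6 * b ^ 2 + 6 * c ^ 2 + 6 * c ^ 2 * a + 4 * a * T)
        * (L + (ν + ν⁻¹ * U + ν⁻¹ ^ 2 * W) * A + νT * Z + ν⁻¹ * H * D + J) := by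
  have h1 : 0 ≤ ν * A := by positivity
  have h2 : 0 ≤ ν⁻¹ * U * A := by positivity
  have h3 : 0 ≤ ν⁻¹ ^ 2 * W * A := by positivity
  have h4 : 0 ≤ νT * Z := by positivity
  have h5 : 0 ≤ ν⁻¹ * H * D := by positivity
  have e1 : (ν + ν⁻¹ * U + ν⁻¹ ^ 2 * W) * A
      = ν * A + ν⁻¹ * U * A + ν⁻¹ ^ 2 * W * A := by ring
  have e2 : 6 * ν⁻¹ * (b ^ 2 * H) * D = 6 * b ^ 2 * (ν⁻¹ * H * D) := by ring
  rw [e1, e2]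
  generalize ν * A = s1 at *
  generalize ν⁻¹ * U * A = s2 at *
  generalize ν⁻¹ ^ 2 * W * A = s3 at *
  generalize νT * Z = s4 at *
  generalize ν⁻¹ * H * D = s5 at *
  set B := L + (s1 + s2 + s3) + s4 + s5 + J with hB
  have q1 : 6 * T * a * s1 ≤ 6 * T * a * B := by gcongr; linarith
  have q2 : 6 * b ^ 2 * s5 ≤ 6 * b ^ 2 * B := by gcongr; linarith
  have q3 : 6 * c ^ 2 * J ≤ 6 * c ^ 2 * B := by gcongr; linarith
  have q4 : 6 * c ^ 2 * a * (s2 + s3) ≤ 6 * c ^ 2 * a * B := by gcongr; linarith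
  have q6 : 4 * a * T * s4 ≤ 4 * a * T * B := by gcongr; linarith
  linarith

/-- Adding the projection error to the bound `X' * G` of the discrete error. -/
theorem full_error_le {a T C₁ C₂ ν νT A Z L B X X' G Lhs : ℝ} (ha : 0 ≤ a) (hT : 0 ≤ T)
    (hC₁ : 0 ≤ C₁) (hC₂ : 0 ≤ C₂) (hB : 0 ≤ B) (hL : L ≤ B) (hA : ν * A ≤ B) (hZ : νT * Z ≤ B)
    (hX : 1 ≤ X) (hXX' : X' ≤ X) (hX' : 0 ≤ X') (hG : G ≤ C₁ * B)
    (h : Lhs ≤ 2 * (a * L) + (T * a / 2 * (νT * Z) + 2 * T * a * (ν * A)) + 2 * (X' * G)) :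
    Lhs ≤ (2 * a + 3 * T * a + 2 * C₁ + C₂ + 1) * X * B := by
  have hXB : B ≤ X * B := le_mul_of_one_le_left hB hX
  have h1 : 2 * (a * L) ≤ 2 * a * (X * B) := by
    rw [← mul_assoc]; gcongr; linarith
  have h2 : T * a / 2 * (νT * Z) ≤ T * a / 2 * (X * B) :=
    mul_le_mul_of_nonneg_left (hZ.trans hXB) (by positivity)
  have h3 : 2 * T * a * (ν * A) ≤ 2 * T * a * (X * B) :=
    mul_le_mul_of_nonneg_left (hA.trans hXB) (by positivity)
  have h4 : X' * G ≤ X * (C₁ * B) := by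
    calc X' * G ≤ X' * (C₁ * B) := by gcongr
      _ ≤ _ := by gcongr
  have h5 : 0 ≤ (T * a / 2 + C₂ + 1) * (X * B) := by positivity
  linarith

theorem sum_const_mul_add_two_mul (M : ℕ) (τ q : ℝ) (G : ℕ → ℝ) :
    ∑ n ∈ Finset.range M, (τ * q + 2 * G n)
      = M * τ * q + 2 * ∑ n ∈ Finset.range M, G n := by
  rw [Finset.sum_add_distrib, Finset.sum_const, Finset.card_range, nsmul_eq_mul,
    ← Finset.mul_sum, mul_assoc]

end Assembly

end VmsPod

end

/-! ### The error estimate -/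

set_option maxHeartbeats 4000000 in
theorem theorem3p1 {d : ℕ} (hd : d = 2 ∨ d = 3)
    (Ω : Set (EuclideanSpace ℝ (Fin d))) (hΩ : IsOpen Ω) (hΩb : Bornology.IsBounded Ω)
    (m : ℕ) (hm : 1 ≤ m) (T : ℝ) (hT : 0 < T) (Cap Ca : ℝ) :
    ∃ C : ℝ, 0 < C ∧
      -- viscosity, eddy viscosity, mesh width, weight of the temporal projection error, time step
      ∀ (ν νT h δ Δt : ℝ) (M : ℕ), 0 < ν → 0 < νT → 0 < h → 0 ≤ δ → 0 < M → Δt = T / M →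
      -- the exact solution
      ∀ (f : ℝ → VelX Ω →ₗ[ℝ] ℝ) (u ut utt : ℝ → L2Vec Ω) (p : ℝ → L2 Ω),
      IsWeakSolution Ω ν T f u ut p → IsRegularSolution Ω m T f u ut utt p →
      -- the discrete spaces
      ∀ (Xh : Submodule ℝ (L2Vec Ω)) (Qh : Submodule ℝ (L2 Ω)),
      Xh ≤ VelX Ω → (∀ q ∈ Qh, MemQ q) →
      (∀ q : L2 Ω, MemQ q → MemH m q →
        Metric.infDist q (Qh : Set (L2 Ω)) ≤ Cap * h ^ m * normH m q) →
      -- snapshots in the discretely divergence free space, and their POD basis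
      ∀ (y : Fin M → L2Vec Ω), (∀ k, y k ∈ Xh ∧ ∀ q ∈ Qh, inner ℝ (divg (y k)) q = 0) →
      ∀ (N : ℕ) (ψ : ℕ → L2Vec Ω) (lam : ℕ → ℝ), IsPODBasis y N ψ lam →
      ∀ (r R : ℕ), R < r → r ≤ N →
      -- the projection assumption
      ∀ U2 : ℝ, U2 = discL2 Δt M (fun n => normHVec (m + 1) (u (n * Δt))) ^ 2 →
      ProjAssumption Ca h δ Δt U2 m M N ψ lam u r →
      ProjAssumption Ca h δ Δt U2 m M N ψ lam u R →
      -- the scheme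
      ∀ (ur w : ℕ → L2Vec Ω), IsVmsPodScheme ν νT Δt M r R ψ f (u 0) ur w →
      -- the time step restriction
      ∀ K : ℝ, K = discMax M (fun n => ‖grad (u (n * Δt))‖) →
      C * (ν⁻¹ ^ 3 * K ^ 4) * Δt ≤ 1 →
      -- the error estimate
      ‖u (M * Δt) - ur M‖ ^ 2
        + ∑ n ∈ Finset.range M,
            (1 / 4 * Δt * νT * ‖fluct ψ R (grad (u ((n + 1 : ℕ) * Δt)
                - (1 / 2 : ℝ) • (ur (n + 1) + w (n + 1))))‖ ^ 2
              + ν * Δt * ‖grad (u ((n + 1 : ℕ) * Δt) - w (n + 1))‖ ^ 2)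
      ≤ C * Real.exp (C * min (ν⁻¹ ^ 3 * K ^ 4) (stiffNorm ψ r ^ (3 / 4 : ℝ) * K)) *
        (h ^ (2 * m + 2) * U2 + δ * Δt ^ 2 + tail N lam r
          + (ν + ν⁻¹ * discL2 Δt M (fun n => ‖grad (u (n * Δt))‖) ^ 2
              + ν⁻¹ ^ 2 * (‖ur 0‖ ^ 2
                  + ν⁻¹ * discL2 Δt M (fun n => normHNeg (f (n * Δt))) ^ 2))
            * ((h ^ (2 * m) + stiffNorm ψ r * h ^ (2 * m + 2)) * U2
                + δ * (1 + stiffNorm ψ r) * Δt ^ 2 + tailH1 N ψ lam r)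
          + νT * ((h ^ (2 * m) + (stiffNorm ψ R + stiffNorm ψ r) * h ^ (2 * m + 2)) * U2
                + δ * (1 + stiffNorm ψ R + stiffNorm ψ r) * Δt ^ 2
                + tailH1 N ψ lam R + tailH1 N ψ lam r)
          + ν⁻¹ * h ^ (2 * m) * discL2 Δt M (fun n => normH m (p (n * Δt))) ^ 2
          + ν⁻¹ * Δt ^ 2 * ∫ t in (0 : ℝ)..T, normHVec 1 (utt t) ^ 2) := by
  obtain ⟨C6, hC6, c, hc, hP, hb, hb'⟩ := exists_abs_triB_le hd hΩ hΩb
  -- The sign of `Ca` is not prescribed, so its nonnegative part is used.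
  set a := max Ca 0 with ha_def
  have ha : 0 ≤ a := le_max_right _ _
  set c1 := c + 216 * c ^ 4 with hc1_def
  have hc1 : 0 ≤ c1 := by positivity
  set C1 := 6 * T * a + 6 * (d * Cap) ^ 2 + 6 * c ^ 2 + 6 * c ^ 2 * a + 4 * a * T with hC1_def
  have hC1 : 0 ≤ C1 := by positivity
  -- One constant plays three roles. The terms `2 * a`, `3 * T * a` and `2 * C1` cover the
  -- projection error at the final time, the projection errors in the dissipation and the summed
  -- sources; `4 * c1` serves the time step restriction, `4 * c1 * T` the exponent, and `1` gives
  -- positivity.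
  refine ⟨2 * a + 3 * T * a + 2 * C1 + (4 * c1 + 4 * c1 * T) + 1, by positivity, ?_⟩
  intro ν νT h δ Δt M hν hνT hh hδ hM hΔt f u ut utt p hsol hreg Xh Qh hXh hQh hQapp y hy N ψ lam
    hpod r R hRr hrN U2 hU2 hprojr hprojR ur w hsch K hK hstep
  have hM' : (0 : ℝ) < M := by exact_mod_cast hM
  have hΔt0 : 0 < Δt := by rw [hΔt]; positivity
  have hMT : M * Δt = T := by rw [hΔt]; field_simp
  have htime {n : ℕ} (hn : n ≤ M) : (n : ℝ) * Δt ∈ Icc 0 T := by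
    refine ⟨by positivity, ?_⟩
    rw [← hMT]
    gcongr
  have htime' {n : ℕ} (hn : n < M) : ((n + 1 : ℕ) : ℝ) * Δt ∈ Ioc 0 T :=
    ⟨by positivity, (htime (n := n + 1) hn).2⟩
  have hyX (k) : y k ∈ VelX Ω := hXh (hy k).1
  have hspan : Submodule.span ℝ (Set.range y) ≤ VelX Ω :=
    Submodule.span_le.2 (by rintro _ ⟨k, rfl⟩; exact hyX k)
  have hXr : podSpace ψ r ≤ VelX Ω := (hpod.podSpace_le hrN).trans hspan
  have hXR : podSpace ψ R ≤ VelX Ω := (hpod.podSpace_le (hRr.le.trans hrN)).trans hspan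
  have hSr := stiffNorm_nonneg ψ r
  have hSR := stiffNorm_nonneg ψ R
  have hU20 : 0 ≤ U2 := by rw [hU2]; positivity
  have htr := hpod.tail_nonneg r
  have htHr := hpod.tailH1_nonneg r
  have htHR := hpod.tailH1_nonneg R
  set L := h ^ (2 * m + 2) * U2 + δ * Δt ^ 2 + tail N lam r with hL_def
  set A := (h ^ (2 * m) + stiffNorm ψ r * h ^ (2 * m + 2)) * U2
                + δ * (1 + stiffNorm ψ r) * Δt ^ 2 + tailH1 N ψ lam r with hA_def
  set Z := (h ^ (2 * m) + (stiffNorm ψ R + stiffNorm ψ r) * h ^ (2 * m + 2)) * U2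
                + δ * (1 + stiffNorm ψ R + stiffNorm ψ r) * Δt ^ 2
                + tailH1 N ψ lam R + tailH1 N ψ lam r with hZ_def
  have hL0 : 0 ≤ L := by positivity
  have hA0 : 0 ≤ A := by positivity
  have hAZ : A ≤ Z := by
    have : 0 ≤ stiffNorm ψ R * h ^ (2 * m + 2) * U2 + δ * stiffNorm ψ R * Δt ^ 2
      + tailH1 N ψ lam R := by positivity
    rw [hA_def, hZ_def]; linarith
  have hZ0 : 0 ≤ Z := hA0.trans hAZ
  have hARZ : (h ^ (2 * m) + stiffNorm ψ R * h ^ (2 * m + 2)) * U2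
                + δ * (1 + stiffNorm ψ R) * Δt ^ 2 + tailH1 N ψ lam R ≤ Z := by
    have : 0 ≤ stiffNorm ψ r * h ^ (2 * m + 2) * U2 + δ * stiffNorm ψ r * Δt ^ 2
      + tailH1 N ψ lam r := by positivity
    rw [hZ_def]; linarith
  have hAR0 : 0 ≤ (h ^ (2 * m) + stiffNorm ψ R * h ^ (2 * m + 2)) * U2
                + δ * (1 + stiffNorm ψ R) * Δt ^ 2 + tailH1 N ψ lam R := by positivity
  set U := discL2 Δt M (fun n => ‖grad (u (n * Δt))‖) ^ 2 with hU_def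
  set F := discL2 Δt M (fun n => normHNeg (f (n * Δt))) ^ 2 with hF_def
  set D := discL2 Δt M (fun n => normH m (p (n * Δt))) ^ 2 with hD_def
  set J := ∫ t in (0 : ℝ)..T, normHVec 1 (utt t) ^ 2 with hJ_def
  have hJ0 : 0 ≤ J := intervalIntegral.integral_nonneg hT.le fun t _ => sq_nonneg _
  have hU0 : 0 ≤ U := sq_nonneg _
  have hF0 : 0 ≤ F := sq_nonneg _
  have hD0 : 0 ≤ D := sq_nonneg _
  set κ := min (ν⁻¹ ^ 3 * K ^ 4) (stiffNorm ψ r ^ (3 / 4 : ℝ) * K) with hκ_def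
  have hK0 : 0 ≤ K := by
    rw [hK]
    exact (norm_nonneg _).trans (le_discMax (Nat.zero_le M) fun n => ‖grad (u (n * Δt))‖)
  have hκ0 : 0 ≤ κ := le_min (by positivity) (by positivity)
  -- The restriction concerns the first entry of the minimum, which dominates `κ`.
  have hk : 2 * Δt * (c1 * κ) ≤ 1 / 2 := by
    have h1 : κ ≤ ν⁻¹ ^ 3 * K ^ 4 := min_le_left _ _
    have h2 : 4 * c1 * κ * Δt ≤ (2 * a + 3 * T * a + 2 * C1 + (4 * c1 + 4 * c1 * T) + 1)
        * (ν⁻¹ ^ 3 * K ^ 4) * Δt := by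
      have : 0 ≤ 2 * a + 3 * T * a + 2 * C1 + 4 * c1 * T + 1 := by positivity
      gcongr
      linarith
    linarith
  -- bounds of the projection errors
  have hLn {n : ℕ} (h1 : 1 ≤ n) (hn : n ≤ M) :
      ‖u (n * Δt) - podProj ψ r (u (n * Δt))‖ ^ 2 ≤ a * L :=
    (hprojr n h1 hn).1.trans (mul_le_mul_of_nonneg_right (le_max_left _ _) hL0)
  have hAn {n : ℕ} (h1 : 1 ≤ n) (hn : n ≤ M) :
      ‖grad (u (n * Δt) - podProj ψ r (u (n * Δt)))‖ ^ 2 ≤ a * A :=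
    (hprojr n h1 hn).2.trans (mul_le_mul_of_nonneg_right (le_max_left _ _) hA0)
  have hRn {n : ℕ} (h1 : 1 ≤ n) (hn : n ≤ M) :
      ‖grad (u (n * Δt) - podProj ψ R (u (n * Δt)))‖ ^ 2 ≤ a * Z :=
    (hprojR n h1 hn).2.trans ((mul_le_mul_of_nonneg_right (le_max_left _ _) hAR0).trans
      (mul_le_mul_of_nonneg_left hARZ ha))
  set v : ℕ → L2Vec Ω := fun n => podProj ψ r (u (n * Δt)) with hv_def
  have hvr (n : ℕ) : v n ∈ podSpace ψ r := podProj_mem _ _ _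
  have huX {n : ℕ} (hn : n ≤ M) : u (n * Δt) ∈ VelX Ω := hsol.mem_X _ (htime hn)
  set I : ℕ → ℝ := fun n => ∫ t in (n * Δt)..((n + 1 : ℕ) * Δt), normHVec 1 (utt t) ^ 2 with hI_def
  have hI0 (n : ℕ) : 0 ≤ I n := by
    refine intervalIntegral.integral_nonneg ?_ fun t _ => sq_nonneg _
    gcongr; omega
  -- the Galerkin step
  have hgal (n : ℕ) (hn : n < M) : ‖w (n + 1) - v (n + 1)‖ ^ 2
        + ν * Δt * ‖grad (w (n + 1) - v (n + 1))‖ ^ 2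
      ≤ ‖ur n - v n‖ ^ 2 + 2 * Δt * (c1 * κ) * ‖w (n + 1) - v (n + 1)‖ ^ 2
        + 2 * Δt * (3 * ν * (a * A)
            + 3 * ν⁻¹ * ((d * Cap) ^ 2 * h ^ (2 * m) * normH m (p ((n + 1 : ℕ) * Δt)) ^ 2)
            + 3 * ν⁻¹ * c ^ 2 * (Δt * I n)
            + 3 * ν⁻¹ * c ^ 2 * (a * A * ‖grad (u ((n + 1 : ℕ) * Δt))‖ ^ 2)
            + 3 * ν⁻¹ * c ^ 2 * (a * A * ‖grad (w (n + 1))‖ ^ 2)) := by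
    have hwr := hsch.mem_w (n + 1) hn
    have hφ : w (n + 1) - v (n + 1) ∈ podSpace ψ r := Submodule.sub_mem _ hwr (hvr _)
    have hmom := hsol.momentum _ (htime' hn) ⟨_, hXr hφ⟩
    have hs1 := hsch.step1 n hn ⟨_, hXr hφ⟩ hφ
    have hpr : |inner ℝ (p ((n + 1 : ℕ) * Δt)) (divg (w (n + 1) - v (n + 1)))|
        ≤ d * (Cap * h ^ m * normH m (p ((n + 1 : ℕ) * Δt)))
          * ‖grad (w (n + 1) - v (n + 1))‖ :=
      abs_inner_divg_le (hQapp _ (hsol.mem_Q _ (htime (n := n + 1) hn))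
        (hreg.p_mem _ (htime (n := n + 1) hn))) fun q hq =>
        inner_divg_eq_zero_of_mem_span hΩ hyX (fun k => (hy k).2 q hq) (hpod.podSpace_le hrN hφ)
    have htc : ‖u ((n + 1 : ℕ) * Δt) - u (n * Δt) - Δt • ut ((n + 1 : ℕ) * Δt)‖ ^ 2
        ≤ Δt ^ 3 * I n := by
      have := norm_sub_sub_smul_sq_le hsol.deriv hreg.utt_meas
        (fun t => norm_le_normHVec_one hΩ (utt t)) hreg.utt_int hreg.utt_deriv
        (a := n * Δt) (b := (n + 1 : ℕ) * Δt) (by positivity) (by gcongr; omega)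
        (htime (n := n + 1) hn).2
      have e : ((n + 1 : ℕ) : ℝ) * Δt - n * Δt = Δt := by push_cast; ring
      rwa [e] at this
    have hproj : inner ℝ (v (n + 1) - v n) (w (n + 1) - v (n + 1))
        = inner ℝ (u ((n + 1 : ℕ) * Δt) - u (n * Δt)) (w (n + 1) - v (n + 1)) := by
      rw [inner_sub_left, inner_sub_left, hv_def]
      simp only
      rw [inner_podProj _ hφ, inner_podProj _ hφ]
    have hKn : ‖grad (u ((n + 1 : ℕ) * Δt))‖ ≤ K := by
      rw [hK]; exact le_discMax (n := n + 1) hn fun n => ‖grad (u (n * Δt))‖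
    have key := galerkin_error_step hΩ hC6 hc hP hb hb' hν hΔt0 hSr (huX (n := n + 1) hn)
      (hXr hwr) (hXr (hvr _)) hmom hs1 hproj hpr htc hKn
      (norm_grad_sq_le_stiffNorm_mul hΩ (hpod.orthonormal hM hrN) hXr hφ)
    refine key.trans ?_
    have hEn := hAn (n := n + 1) (by omega) hn
    have e2 : (d * (Cap * h ^ m * normH m (p ((n + 1 : ℕ) * Δt)))) ^ 2
        = (d * Cap) ^ 2 * h ^ (2 * m) * normH m (p ((n + 1 : ℕ) * Δt)) ^ 2 := by
      rw [mul_comm 2 m, pow_mul]; ring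
    rw [e2]
    gcongr
  -- the post-processing step
  set θ : ℕ → L2Vec Ω := fun n =>
    (1 / 2 : ℝ) • ((w (n + 1) - v (n + 1)) + (ur (n + 1) - v (n + 1))) with hθ_def
  have hpost (n : ℕ) (hn : n < M) : ‖ur (n + 1) - v (n + 1)‖ ^ 2
        + Δt * νT * ‖fluct ψ R (grad (θ n))‖ ^ 2
      ≤ ‖w (n + 1) - v (n + 1)‖ ^ 2 + Δt * νT * (4 * (a * Z)) := by
    have hwr := hsch.mem_w (n + 1) hn
    have hurr := hsch.mem_ur (n + 1) hn
    have hs2 := hsch.step2 n hn (θ n) (Submodule.smul_mem _ _ (Submodule.add_mem _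
      (Submodule.sub_mem _ hwr (hvr _)) (Submodule.sub_mem _ hurr (hvr _))))
    refine (postprocessing_error_step hΩ hνT hΔt0 (hXr hwr) (hXr hurr) (hXr (hvr _)) hs2).trans ?_
    have h1 := norm_fluct_grad_proj_sq_le hΩ hXr hXR (huX (n := n + 1) hn)
    have h2 := hAn (n := n + 1) (by omega) hn
    have h3 := hRn (n := n + 1) (by omega) hn
    have h4 : a * A ≤ a * Z := mul_le_mul_of_nonneg_left hAZ ha
    gcongr
    linarith
  have haA : 0 ≤ a * A := mul_nonneg ha hA0
  have haZ : 0 ≤ a * Z := mul_nonneg ha hZ0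
  -- The index of `x` is shifted: `x n` is the intermediate Galerkin error at time `(n + 1) * Δt`,
  -- between `a n` and `a (n + 1)`.
  have hgron := discrete_gronwall (a := fun n => ‖ur n - v n‖ ^ 2)
    (x := fun n => ‖w (n + 1) - v (n + 1)‖ ^ 2) (k := 2 * Δt * (c1 * κ)) (M := M)
    (D := fun n => ν * Δt * ‖grad (w (n + 1) - v (n + 1))‖ ^ 2)
    (D' := fun n => Δt * νT * ‖fluct ψ R (grad (θ n))‖ ^ 2)
    (by positivity) hk (fun _ => sq_nonneg _)
    (fun n => by
      have := hI0 n
      positivity)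
    (fun n => by positivity) (fun n => by positivity) (fun n => by positivity) hgal hpost
  have hinit : ‖ur 0 - v 0‖ ^ 2 = 0 := by simp [hv_def, hsch.init_ur]
  simp only [hinit, zero_add] at hgron
  -- summation of the right-hand sides
  have hstab := hsch.stability hν hνT hΔt0 hXr fun n hn => hreg.f_mem _ (htime (n := n + 1) hn)
  have hsF := sum_succ_le_discL2_sq hΔt0.le M fun n => normHNeg (f (n * Δt))
  have hstab' : ν * ∑ n ∈ Finset.range M, Δt * ‖grad (w (n + 1))‖ ^ 2
      ≤ ‖ur 0‖ ^ 2 + ν⁻¹ * F := by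
    refine hstab.trans ?_
    gcongr
  have hsU := sum_succ_le_discL2_sq hΔt0.le M fun n => ‖grad (u (n * Δt))‖
  have hsD := sum_succ_le_discL2_sq hΔt0.le M fun n => normH m (p (n * Δt))
  have hsI : ∑ n ∈ Finset.range M, I n = J := sum_intervalIntegral_steps hΔt0 hMT hreg.utt_int
  have hsum := sum_error_sources_le (νT := νT) (Z := Z) (c := c)
    (q := (d * Cap) ^ 2 * h ^ (2 * m)) hMT hν haA (by positivity) hsD hsI hsU hstab'
  have hsum' := hsum.trans (error_sources_le (T := T) (a := a) (b := d * Cap) (c := c)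
    (W := ‖ur 0‖ ^ 2 + ν⁻¹ * F) (L := L) (H := h ^ (2 * m)) hT.le ha hν hνT.le hA0 hZ0 hL0 hU0
    (by positivity) (by positivity) hD0 (by positivity : 0 ≤ ν⁻¹ * Δt ^ 2 * J))
  set B := L + (ν + ν⁻¹ * U + ν⁻¹ ^ 2 * (‖ur 0‖ ^ 2 + ν⁻¹ * F)) * A + νT * Z
    + ν⁻¹ * h ^ (2 * m) * D + ν⁻¹ * Δt ^ 2 * J with hB_def
  have hB1 : 0 ≤ (ν⁻¹ * U + ν⁻¹ ^ 2 * (‖ur 0‖ ^ 2 + ν⁻¹ * F)) * A := by positivity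
  have hB2 : 0 ≤ ν⁻¹ * h ^ (2 * m) * D := by positivity
  have hB3 : 0 ≤ ν⁻¹ * Δt ^ 2 * J := by positivity
  have hB4 : 0 ≤ νT * Z := by positivity
  have hB5 : 0 ≤ ν * A := by positivity
  have hB0 : 0 ≤ B := by linarith
  have hexp : Real.exp (2 * (2 * Δt * (c1 * κ)) * M)
      ≤ Real.exp ((2 * a + 3 * T * a + 2 * C1 + (4 * c1 + 4 * c1 * T) + 1) * κ) := by
    rw [Real.exp_le_exp]
    -- The growth over `M` steps depends only on the total time `T`.
    have e : 2 * (2 * Δt * (c1 * κ)) * M = 4 * c1 * T * κ := by rw [← hMT]; ring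
    rw [e]
    have : 0 ≤ 2 * a + 3 * T * a + 2 * C1 + 4 * c1 + 1 := by positivity
    gcongr
    linarith
  have hLB : L ≤ B := by linarith
  have hAB : ν * A ≤ B := by linarith
  have hZB : νT * Z ≤ B := by linarith
  refine full_error_le ha hT.le hC1 (by positivity : 0 ≤ 4 * c1 + 4 * c1 * T) hB0
    hLB hAB hZB (Real.one_le_exp (by positivity)) hexp
    (Real.exp_pos _).le hsum' ?_
  -- from the discrete error to the full error
  have hend : ‖u (M * Δt) - ur M‖ ^ 2 ≤ 2 * (a * L) + 2 * ‖ur M - v M‖ ^ 2 := by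
    have e : u (M * Δt) - ur M = (u (M * Δt) - v M) - (ur M - v M) := by abel
    rw [e]
    have := hLn (n := M) hM le_rfl
    exact (norm_sub_sq_le_two_mul _ _).trans (by gcongr)
  have hterm (n : ℕ) (hn : n ∈ Finset.range M) :
      1 / 4 * Δt * νT * ‖fluct ψ R (grad (u ((n + 1 : ℕ) * Δt)
          - (1 / 2 : ℝ) • (ur (n + 1) + w (n + 1))))‖ ^ 2
        + ν * Δt * ‖grad (u ((n + 1 : ℕ) * Δt) - w (n + 1))‖ ^ 2
      ≤ Δt * (a / 2 * (νT * Z) + 2 * a * (ν * A))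
        + 2 * (ν * Δt * ‖grad (w (n + 1) - v (n + 1))‖ ^ 2
          + Δt * νT * ‖fluct ψ R (grad (θ n))‖ ^ 2) := by
    replace hn := Finset.mem_range.1 hn
    have hwr := hXr (hsch.mem_w (n + 1) hn)
    have hurr := hXr (hsch.mem_ur (n + 1) hn)
    have hvX := hXr (hvr (n + 1))
    have huX' := huX (n := n + 1) hn
    have hη := Submodule.sub_mem _ huX' hvX
    have hφ := Submodule.sub_mem _ hwr hvX
    have hθX : θ n ∈ VelX Ω := Submodule.smul_mem _ _ (Submodule.add_mem _
      hφ (Submodule.sub_mem _ hurr hvX))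
    have e1 : u ((n + 1 : ℕ) * Δt) - (1 / 2 : ℝ) • (ur (n + 1) + w (n + 1))
        = (u ((n + 1 : ℕ) * Δt) - v (n + 1)) - θ n := by
      simp only [hθ_def]; module
    have e2 : u ((n + 1 : ℕ) * Δt) - w (n + 1)
        = (u ((n + 1 : ℕ) * Δt) - v (n + 1)) - (w (n + 1) - v (n + 1)) := by abel
    rw [e1, e2, grad_sub hΩ hη hθX, grad_sub hΩ hη hφ, fluct_sub]
    have hE := hAn (n := n + 1) (by omega) hn
    have hE' := hE.trans (mul_le_mul_of_nonneg_left hAZ ha)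
    -- The fluctuation operator is a contraction, so the gradient error of the projection onto
    -- `podSpace ψ r` suffices here.
    have hfl : ‖fluct ψ R (grad (u ((n + 1 : ℕ) * Δt) - v (n + 1)))‖ ^ 2 ≤ a * Z :=
      (pow_le_pow_left₀ (norm_nonneg _) (norm_fluct_le _ _ _) 2).trans hE'
    have s1 := norm_sub_sq_le_two_mul (fluct ψ R (grad (u ((n + 1 : ℕ) * Δt) - v (n + 1))))
      (fluct ψ R (grad (θ n)))
    have s2 := norm_sub_sq_le_two_mul (grad (u ((n + 1 : ℕ) * Δt) - v (n + 1)))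
      (grad (w (n + 1) - v (n + 1)))
    have s1' := s1.trans (add_le_add_left (mul_le_mul_of_nonneg_left hfl zero_le_two) _)
    have s2' := s2.trans (add_le_add_left (mul_le_mul_of_nonneg_left hE zero_le_two) _)
    have t1 := mul_le_mul_of_nonneg_left s1' (by positivity : 0 ≤ 1 / 4 * Δt * νT)
    have t2 := mul_le_mul_of_nonneg_left s2' (by positivity : 0 ≤ ν * Δt)
    have t3 : 0 ≤ Δt * νT * ‖fluct ψ R (grad (θ n))‖ ^ 2 := by positivity
    linarith
  have hsumt := (Finset.sum_le_sum hterm).trans_eq (sum_const_mul_add_two_mul M Δt _ _)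
  rw [hMT] at hsumt
  linarith
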